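/- Let $\mathcal H$ be a separable infinite-dimensional complex Hilbert space and let $G$ be an unbounded positive semidefinite self-adjoint (in particular densely defined) operator on $\mathcal H$ with domain $\mathcal D(G)$ such that $\inf\{\|G\varphi\| : \varphi\in\mathcal D(G),\ \|\varphi\|=1\}=0$. For $\varphi\in\mathcal H$ put $\langle\varphi|G|\varphi\rangle=\|\sqrt G\varphi\|^2$ if $\varphi\in\mathcal D(\sqrt G)$ and $\langle\varphi|G|\varphi\rangle=+\infty$ otherwise. For a positive trace-class operator $\rho$ put $\operatorname{Tr}G\rho=\sup_n\operatorname{Tr}P_nG\rho\in[0,+\infty]$, where $P_n$ is the spectral projector of $G$ corresponding to $[0,n]$ and $P_nG$ denotes its bounded extension to $\mathcal H$. A linear operator $A$ on $\mathcal H$ is called $\sqrt G$-bounded if $\mathcal D(A)\supseteq\mathcal D(\sqrt G)$ and there are $a,b\ge 0$ with $\|A\varphi\|^2\le a^2\|\varphi\|^2+b^2\|\sqrt G\varphi\|^2$ for all $\varphi\in\mathcal D(\sqrt G)$. For such $A$ and a positive trace-class operator $\rho$ with $\operatorname{Tr}G\rho<\infty$ put $$A\rho A^*\doteq\sum_i|A\varphi_i\rangle\langle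 A\varphi_i|,$$ where $\rho=\sum_i|\varphi_i\rangle\langle\varphi_i|$ is any countable decomposition of $\rho$ into positive operators of rank at most one; such decompositions exist, all the $\varphi_i$ lie in $\mathcal D(A)$, the series converges, and its sum is a positive trace-class operator that does not depend on the decomposition. Let $A$ be an arbitrary $\sqrt G$-bounded operator and $E>0$. Then: A) The two quantities $$\sup_{\|\varphi\|=1,\ \langle\varphi|G|\varphi\rangle\le E}\|A\varphi\|\qquad\text{and}\qquad \sup_{\rho\ge 0,\ \operatorname{Tr}\rho=1,\ \operatorname{Tr}G\rho\le E}\sqrt{\operatorname{Tr}A\rho A^*}$$ are suprema of nonempty bounded sets and coincide. Their common value is denoted by $\|A\|^G_E$. B) These suprema can be taken, respectively, over all vectors of the unit ball and over all positive trace-class operators of trace at most one: $$\|A\|^G_E=\sup_{\|\varphi\|\le 1,\ \langle\varphi|G|\varphi\rangle\le E}\|A\varphi\|=\sup_{\rho\ge 0,\ \operatorname{Tr}\rho\le 1,\ \operatorname{Tr}G\rho\le E}\sqrt{\operatorname{Tr}A\rho A^*}.$$ -/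

import Mathlib

open scoped ENNReal InnerProductSpace

namespace EnergyNorm

noncomputable section

section Spectral

variable {H : Type*} [NormedAddCommGroup H] [InnerProductSpace ℂ H] [CompleteSpace H]

/-- A spectral family (resolution of the identity) on the Hilbert space `H`: an increasing,
strongly right-continuous family of orthogonal projections, with strong limits `0` at `-∞` and
`I` at `+∞`. -/
structure SpectralFamily (H : Type*) [NormedAddCommGroup H] [InnerProductSpace ℂ H]
    [CompleteSpace H] where
  proj : ℝ → H →L[ℂ] H
  isStarProjection : ∀ t, IsStarProjection (proj t)
  mul_eq_of_le : ∀ s t, s ≤ t → proj s * proj t = proj s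
  right_continuous : ∀ (x : H) (t : ℝ),
    ContinuousWithinAt (fun s => proj s x) (Set.Ici t) t
  tendsto_atBot : ∀ x : H, Filter.Tendsto (fun t => proj t x) Filter.atBot (nhds 0)
  tendsto_atTop : ∀ x : H, Filter.Tendsto (fun t => proj t x) Filter.atTop (nhds x)

/-- The distribution function `t ↦ ‖E_t x‖² = ⟨x|E_t|x⟩`. -/
def SpectralFamily.distribution (E : SpectralFamily H) (x : H) : StieltjesFunction ℝ where
  toFun t := ‖E.proj t x‖ ^ 2
  mono' := by
    intro s t hst
    have h : E.proj s x = E.proj s (E.proj t x) := by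
      conv_lhs => rw [← E.mul_eq_of_le s t hst]
      rfl
    have h2 : ‖E.proj s x‖ ≤ ‖E.proj t x‖ := by
      rw [h]
      exact (ContinuousLinearMap.le_of_opNorm_le _ (E.isStarProjection s).norm_le _).trans
        (by simp)
    show ‖E.proj s x‖ ^ 2 ≤ ‖E.proj t x‖ ^ 2
    gcongr
  right_continuous' t := ((E.right_continuous x t).norm.pow 2)

/-- The spectral measure of the vector `x`, i.e. the Borel measure `d⟨x|E_t|x⟩` on `ℝ`. -/
def SpectralFamily.measure (E : SpectralFamily H) (x : H) : MeasureTheory.Measure ℝ :=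
  (E.distribution x).measure

/-- `G = ∫ t dE_t`: the domain of `G` consists of the vectors `x` with `∫ t² d⟨x|E_t|x⟩ < ∞`, and
`⟨x|G|x⟩ = ∫ t d⟨x|E_t|x⟩` for these vectors. -/
def SpectralFamily.IsResolutionOf (E : SpectralFamily H) (G : H →ₗ.[ℂ] H) : Prop :=
  (∀ x : H, x ∈ G.domain ↔ ∫⁻ t, ENNReal.ofReal (t ^ 2) ∂(E.measure x) < ∞) ∧
  ∀ x : G.domain, ⟪(x : H), G x⟫_ℂ = ((∫ t, t ∂(E.measure (x : H)) : ℝ) : ℂ)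

/-- `G` is a positive (semidefinite) self-adjoint operator; self-adjointness includes that its
domain is dense. -/
def IsPositiveSelfAdjoint (G : H →ₗ.[ℂ] H) : Prop :=
  IsSelfAdjoint G ∧ ∀ x : G.domain, 0 ≤ (⟪(x : H), G x⟫_ℂ).re

open Classical in
/-- The spectral projector of a positive self-adjoint operator `G` corresponding to the interval
`[0, t]`. It equals `E_t`, where `E` is the spectral family of `G`, since `G` has no spectrum in
`(-∞, 0)`. -/
def spectralProjector (G : H →ₗ.[ℂ] H) (t : ℝ) : H →L[ℂ] H :=
  if h : ∃ E : SpectralFamily H, E.IsResolutionOf G then h.choose.proj t else 0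

/-- `S` is a positive self-adjoint operator with `S² = G` (equality of domains included). -/
def IsPositiveSqrt (S G : H →ₗ.[ℂ] H) : Prop :=
  IsPositiveSelfAdjoint S ∧
  ∀ x y : H, (x, y) ∈ G.graph ↔ ∃ z : H, (x, z) ∈ S.graph ∧ (z, y) ∈ S.graph

open Classical in
/-- The positive square root `√G` of a positive self-adjoint operator `G`. -/
def sqrtOp (G : H →ₗ.[ℂ] H) : H →ₗ.[ℂ] H :=
  if h : ∃ S : H →ₗ.[ℂ] H, IsPositiveSqrt S G then h.choose else 0

open Classical in
/-- The bounded operator `P_t G`, i.e. the continuous extension to `H` of `x ↦ P_t (G x)` from the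
domain of `G`, where `P_t` is the spectral projector of `G` for `[0, t]`. -/
def truncation (G : H →ₗ.[ℂ] H) (t : ℝ) : H →L[ℂ] H :=
  if h : ∃ B : H →L[ℂ] H, ∀ x : G.domain, B (x : H) = spectralProjector G t (G x)
  then h.choose else 0

/-- An index set of an orthonormal basis of `H`. -/
def basisSet (H : Type*) [NormedAddCommGroup H] [InnerProductSpace ℂ H] [CompleteSpace H] :
    Set H :=
  (exists_hilbertBasis ℂ H).choose

/-- An orthonormal basis of `H`, used to compute traces. -/
def basis (H : Type*) [NormedAddCommGroup H] [InnerProductSpace ℂ H] [CompleteSpace H] :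
    HilbertBasis (basisSet H) ℂ H :=
  (exists_hilbertBasis ℂ H).choose_spec.choose

/-- `T` is a trace-class operator: `Tr |T| < ∞`. -/
def IsTraceClass (T : H →L[ℂ] H) : Prop :=
  Summable fun i => (⟪basis H i, CFC.abs T (basis H i)⟫_ℂ).re

/-- The trace of a trace-class operator. -/
def trace (T : H →L[ℂ] H) : ℂ :=
  ∑' i, ⟪basis H i, T (basis H i)⟫_ℂ

/-- The cone `𝔗₊(H)` of positive trace-class operators. -/
def PosTraceClass (H : Type*) [NormedAddCommGroup H] [InnerProductSpace ℂ H] [CompleteSpace H] :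
    Set (H →L[ℂ] H) :=
  {ρ | ρ.IsPositive ∧ IsTraceClass ρ}

/-- The set `𝔖(H)` of states: positive operators of trace `1`. -/
def States (H : Type*) [NormedAddCommGroup H] [InnerProductSpace ℂ H] [CompleteSpace H] :
    Set (H →L[ℂ] H) :=
  {ρ | ρ ∈ PosTraceClass H ∧ trace ρ = 1}

/-- The positive part `𝔗₊,₁(H)` of the unit ball of the trace class. -/
def SubStates (H : Type*) [NormedAddCommGroup H] [InnerProductSpace ℂ H] [CompleteSpace H] :
    Set (H →L[ℂ] H) :=
  {ρ | ρ ∈ PosTraceClass H ∧ (trace ρ).re ≤ 1}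

/-- `Tr Gρ = sup_n Tr P_n G ρ ∈ [0, +∞]` for a positive trace-class operator `ρ`, where `P_n` is
the spectral projector of `G` corresponding to `[0, n]`. -/
def energy (G : H →ₗ.[ℂ] H) (ρ : H →L[ℂ] H) : ℝ≥0∞ :=
  ⨆ n : ℕ, ENNReal.ofReal (trace (truncation G n * ρ)).re

/-- `A` is a `√G`-bounded operator: it is defined on (at least) the domain of `√G`, and
`‖Aφ‖² ≤ a²‖φ‖² + b²‖√G φ‖²` there for some nonnegative numbers `a`, `b`. -/
def IsSqrtBounded (G A : H →ₗ.[ℂ] H) : Prop :=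
  ∃ hA : (sqrtOp G).domain ≤ A.domain, ∃ a b : ℝ, 0 ≤ a ∧ 0 ≤ b ∧
    ∀ φ : (sqrtOp G).domain,
      ‖A ⟨φ, hA φ.2⟩‖ ^ 2 ≤ a ^ 2 * ‖(φ : H)‖ ^ 2 + b ^ 2 * ‖sqrtOp G φ‖ ^ 2

/-- `ρ = ∑ᵢ |φᵢ⟩⟨φᵢ|`. Zero vectors are allowed, so finite decompositions are included. -/
def IsDecomposition (φ : ℕ → H) (ρ : H →L[ℂ] H) : Prop :=
  HasSum (fun i => InnerProductSpace.rankOne ℂ (φ i) (φ i)) ρ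

/-- `τ = ∑ᵢ |Aφᵢ⟩⟨Aφᵢ|` for vectors `φᵢ` that all lie in the domain of `A`. -/
def IsImageSum (A : H →ₗ.[ℂ] H) (φ : ℕ → H) (τ : H →L[ℂ] H) : Prop :=
  ∃ hφ : ∀ i, φ i ∈ A.domain,
    HasSum (fun i => InnerProductSpace.rankOne ℂ (A ⟨φ i, hφ i⟩) (A ⟨φ i, hφ i⟩)) τ

open Classical in
/-- The operator `AρA* = ∑ᵢ |Aφᵢ⟩⟨Aφᵢ|`, where `ρ = ∑ᵢ |φᵢ⟩⟨φᵢ|` is a decomposition of `ρ`. -/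
def sandwich (A : H →ₗ.[ℂ] H) (ρ : H →L[ℂ] H) : H →L[ℂ] H :=
  if h : ∃ τ : H →L[ℂ] H, ∃ φ : ℕ → H, IsDecomposition φ ρ ∧ IsImageSum A φ τ
  then h.choose else 0

/-- The numbers `‖Aφ‖`, where `φ` runs over the vectors in `V` with `⟨φ|G|φ⟩ ≤ E`. Here
`⟨φ|G|φ⟩ = ‖√G φ‖²` if `φ` lies in the domain of `√G`, and `⟨φ|G|φ⟩ = +∞` otherwise. -/
def vectorValues (G A : H →ₗ.[ℂ] H) (E : ℝ) (V : Set H) : Set ℝ :=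
  {r | ∃ (φ : (sqrtOp G).domain) (hφ : (φ : H) ∈ A.domain), (φ : H) ∈ V ∧
    ‖sqrtOp G φ‖ ^ 2 ≤ E ∧ r = ‖A ⟨φ, hφ⟩‖}

/-- The numbers `√(Tr AρA*)`, where `ρ` runs over the operators in `W` with `Tr Gρ ≤ E`. -/
def stateValues (G A : H →ₗ.[ℂ] H) (E : ℝ) (W : Set (H →L[ℂ] H)) : Set ℝ :=
  {r | ∃ ρ ∈ W, energy G ρ ≤ ENNReal.ofReal E ∧ r = √(trace (sandwich A ρ)).re}

/-- The operator `E`-norm `‖A‖^G_E`: the supremum of `‖Aφ‖` over the unit vectors `φ` with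
`⟨φ|G|φ⟩ ≤ E`. -/
def operatorENorm (G A : H →ₗ.[ℂ] H) (E : ℝ) : ℝ :=
  sSup (vectorValues G A E (Metric.sphere 0 1))

end Spectral

end

end EnergyNorm

/-! A unit vector gives a pure state, so the vector values lie among the state values, and these lie
among the values over subnormalised operators. What remains is to bound ‖Aφ‖ on the unit ball, and
√(Tr AρA*) on subnormalised ρ, by the supremum over unit vectors.

Both bounds rest on a convexity fact, `exists_sum_two`. On the domain of √G there are three
quadratic forms: ‖φ‖², ‖√Gφ‖² and ‖Aφ‖². Given u and v, the combinations αu + βv with |α|² + |β|² =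
2 are parametrised, up to phase, by the Bloch sphere, and each form there equals its total on u and
v plus a linear functional of the Bloch vector. Two linear functionals on ℝ³ vanish together on a
line, and one of the two opposite unit vectors of that line makes the third nonnegative. Hence a
finite family collapses to one vector with the same total norm and energy and at least the same
total of ‖Aφ‖².

Applied to partial sums of ρ = ∑ |φᵢ⟩⟨φᵢ|, this reduces states to vectors of the unit ball. A vector
of the ball is shrunk by c < 1, and the missing norm is supplied by a unit vector of energy at most
(1 − c²)E, which exists because inf ‖Gφ‖ = 0; then c → 1 (`norm_le_operatorENorm`).

The rest supports this argument: √G and the spectral resolution of G are built from the bounded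
resolvent (1 + G)⁻¹; cut-offs give √G Pₙx → √Gx and Tr Gρ = ∑ ‖√Gφᵢ‖²; `decomposition_unique` makes
AρA* well defined. The root and the projectors are obtained by choice, so their properties are
derived from the defining conditions alone. -/

namespace EnergyNorm
-- Self-adjoint operators through their graphs, the resolvent, and the positive square root.
section SelfAdjoint

set_option linter.unusedSectionVars false

variable {H : Type*} [NormedAddCommGroup H] [InnerProductSpace ℂ H] [CompleteSpace H]

theorem re_inner_self (x : H) : (⟪x, x⟫_ℂ).re = ‖x‖ ^ 2 :=
  inner_self_eq_norm_sq (𝕜 := ℂ) x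

theorem inner_eq_of_mem_graph {T : H →ₗ.[ℂ] H} (hT : IsSelfAdjoint T) {x y x' y' : H}
    (h : (x, y) ∈ T.graph) (h' : (x', y') ∈ T.graph) : ⟪y, x'⟫_ℂ = ⟪x, y'⟫_ℂ := by
  have hd := hT.dense_domain
  have hadj := LinearPMap.adjoint_isFormalAdjoint (T := T) hd
  rw [LinearPMap.isSelfAdjoint_def.mp hT] at hadj
  rw [LinearPMap.mem_graph_iff] at h h'
  obtain ⟨u, hu1, hu2⟩ := h
  obtain ⟨v, hv1, hv2⟩ := h'
  have := hadj u v
  simp only at hu1 hu2 hv1 hv2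
  rw [← hu1, ← hu2, ← hv1, ← hv2]
  exact this

theorem mem_graph_of_forall_inner_eq {T : H →ₗ.[ℂ] H} (hT : IsSelfAdjoint T) {x y : H}
    (h : ∀ x' y' : H, (x', y') ∈ T.graph → ⟪y, x'⟫_ℂ = ⟪x, y'⟫_ℂ) : (x, y) ∈ T.graph := by
  have hd := hT.dense_domain
  have h1 : ∀ z : T.domain, ⟪y, (z : H)⟫_ℂ = ⟪x, T z⟫_ℂ := fun z => h _ _ (T.mem_graph z)
  have hx : x ∈ (LinearPMap.adjoint T).domain :=
    LinearPMap.mem_adjoint_domain_of_exists x ⟨y, h1⟩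
  have h2 : LinearPMap.adjoint T ⟨x, hx⟩ = y := LinearPMap.adjoint_apply_eq hd ⟨x, hx⟩ h1
  have h3 : (x, y) ∈ (LinearPMap.adjoint T).graph := by
    rw [LinearPMap.mem_graph_iff]
    exact ⟨⟨x, hx⟩, rfl, h2⟩
  rwa [LinearPMap.isSelfAdjoint_def.mp hT] at h3

/-- A bound of this kind is membership in the domain of T* = T. It is the criterion by which limits
of cut-offs are shown to lie in a domain. -/
theorem exists_mem_graph_of_norm_inner_le {T : H →ₗ.[ℂ] H} (hT : IsSelfAdjoint T) {x : H} (C : ℝ)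
    (h : ∀ x' y' : H, (x', y') ∈ T.graph → ‖⟪x, y'⟫_ℂ‖ ≤ C * ‖x'‖) : ∃ y, (x, y) ∈ T.graph := by
  have hx : x ∈ (LinearPMap.adjoint T).domain := by
    rw [LinearPMap.mem_adjoint_domain_iff]
    exact AddMonoidHomClass.continuous_of_bound _ C fun z => h _ _ (T.mem_graph z)
  rw [LinearPMap.isSelfAdjoint_def.mp hT] at hx
  exact ⟨T ⟨x, hx⟩, T.mem_graph ⟨x, hx⟩⟩

theorem isSelfAdjoint_of_graph {T : H →ₗ.[ℂ] H} (hd : Dense (T.domain : Set H))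
    (hsymm : ∀ x y x' y' : H, (x, y) ∈ T.graph → (x', y') ∈ T.graph → ⟪y, x'⟫_ℂ = ⟪x, y'⟫_ℂ)
    (hmax : ∀ x y : H, (∀ x' y' : H, (x', y') ∈ T.graph → ⟪y, x'⟫_ℂ = ⟪x, y'⟫_ℂ) →
      (x, y) ∈ T.graph) : IsSelfAdjoint T := by
  rw [LinearPMap.isSelfAdjoint_def]
  apply le_antisymm
  · apply LinearPMap.le_of_le_graph
    rintro ⟨x, y⟩ hxy
    apply hmax
    intro x' y' h'
    rw [LinearPMap.mem_graph_iff] at hxy h'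
    obtain ⟨u, rfl, rfl⟩ := hxy
    obtain ⟨v, rfl, rfl⟩ := h'
    exact LinearPMap.adjoint_isFormalAdjoint hd u v
  · apply LinearPMap.IsFormalAdjoint.le_adjoint hd
    intro x y
    exact hsymm _ _ _ _ (T.mem_graph x) (T.mem_graph y)

theorem re_inner_nonneg_of_mem_graph {T : H →ₗ.[ℂ] H} (hT : IsPositiveSelfAdjoint T) {x y : H}
    (h : (x, y) ∈ T.graph) : 0 ≤ (⟪x, y⟫_ℂ).re := by
  rw [LinearPMap.mem_graph_iff] at h
  obtain ⟨u, rfl, rfl⟩ := h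
  exact hT.2 u

theorem norm_le_norm_add_of_mem_graph {T : H →ₗ.[ℂ] H} (hT : IsPositiveSelfAdjoint T) {x y : H}
    (h : (x, y) ∈ T.graph) : ‖x‖ ≤ ‖x + y‖ := by
  have h0 := re_inner_nonneg_of_mem_graph hT h
  have h1 : ‖x + y‖ ^ 2 = ‖x‖ ^ 2 + 2 * (⟪x, y⟫_ℂ).re + ‖y‖ ^ 2 := norm_add_sq (𝕜 := ℂ) x y
  refine le_of_sq_le_sq ?_ (norm_nonneg _)
  nlinarith [sq_nonneg ‖y‖]

/-- The resolvent `R = (1 + G)⁻¹` of a positive self-adjoint operator. -/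
structure IsResolvent (G : H →ₗ.[ℂ] H) (R : H →L[ℂ] H) : Prop where
  isPositive : R.IsPositive
  norm_le : ‖R‖ ≤ 1
  mem_graph_iff : ∀ x y : H, (x, y) ∈ G.graph ↔ R (x + y) = x

/-- The map (x, y) ↦ x + y on the closed graph of G is bounded below, because Re⟨x, y⟩ ≥ 0. Its
range is therefore closed, and it is dense as well; R is the inverse followed by the first
coordinate. -/
theorem exists_isResolvent {G : H →ₗ.[ℂ] H} (hG : IsPositiveSelfAdjoint G) :
    ∃ R : H →L[ℂ] H, IsResolvent G R := by
  let f : G.graph →L[ℂ] H :=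
    (ContinuousLinearMap.fst ℂ H H + ContinuousLinearMap.snd ℂ H H).comp G.graph.subtypeL
  have hf : ∀ z : G.graph, f z = (z : H × H).1 + (z : H × H).2 := fun z => rfl
  have hfst : ∀ z : G.graph, ‖(z : H × H).1‖ ≤ ‖f z‖ := fun z =>
    norm_le_norm_add_of_mem_graph hG z.2
  have hclosed : IsClosed (G.graph : Set (H × H)) := hG.1.isClosed
  have : CompleteSpace G.graph := hclosed.completeSpace_coe
  have hanti : AntilipschitzWith 2 f := by
    apply f.antilipschitz_of_bound
    intro z
    have h2 : ‖(z : H × H).2‖ ≤ 2 * ‖f z‖ := by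
      have : (z : H × H).2 = f z - (z : H × H).1 := by rw [hf]; abel
      rw [this]
      linarith [norm_sub_le (f z) (z : H × H).1, hfst z]
    show ‖(z : H × H)‖ ≤ _
    rw [Prod.norm_def]
    exact max_le (by push_cast; linarith [hfst z, norm_nonneg (f z)]) (by push_cast; exact h2)
  have hker : f.ker = ⊥ := by
    rw [LinearMap.ker_eq_bot]; exact hanti.injective
  have hrange : f.range = ⊤ := by
    have hcl : IsClosed (f.range : Set H) := by
      rw [LinearMap.coe_range]; exact hanti.isClosed_range f.uniformContinuous
    rw [← hcl.submodule_topologicalClosure_eq, Submodule.topologicalClosure_eq_top_iff,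
      Submodule.eq_bot_iff]
    intro w hw
    rw [Submodule.mem_orthogonal'] at hw
    -- A vector orthogonal to the range would be an eigenvector of G for −1, which positivity
    -- excludes.
    have hg : (w, -w) ∈ G.graph := by
      apply mem_graph_of_forall_inner_eq hG.1
      intro x' y' h'
      have h2 : ⟪w, x' + y'⟫_ℂ = 0 := hw (x' + y') ⟨⟨(x', y'), h'⟩, rfl⟩
      rw [inner_add_right] at h2
      rw [inner_neg_left]
      linear_combination -h2
    have h3 := re_inner_nonneg_of_mem_graph hG hg
    rw [inner_neg_right, Complex.neg_re, re_inner_self] at h3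
    have : ‖w‖ ^ 2 = 0 := le_antisymm (by linarith) (sq_nonneg _)
    simpa using this
  let e := ContinuousLinearEquiv.ofBijective f hker hrange
  let R : H →L[ℂ] H := ((ContinuousLinearMap.fst ℂ H H).comp G.graph.subtypeL).comp
    (e.symm : H →L[ℂ] G.graph)
  have hR : ∀ w, R w = (e.symm w : H × H).1 := fun w => rfl
  have hRg : ∀ w, (R w, w - R w) ∈ G.graph := by
    intro w
    have h1 : (e.symm w : H × H).1 + (e.symm w : H × H).2 = w := e.apply_symm_apply w
    have h2 : (R w, w - R w) = (e.symm w : H × H) := by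
      ext
      · rfl
      · show w - R w = _
        rw [hR, sub_eq_iff_eq_add, add_comm, h1]
    rw [h2]
    exact (e.symm w).2
  refine ⟨R, ⟨?_, ?_, ?_⟩⟩
  · rw [ContinuousLinearMap.isPositive_def]
    refine ⟨?_, ?_⟩
    · intro u v
      have h := inner_eq_of_mem_graph hG.1 (hRg u) (hRg v)
      rw [inner_sub_left, inner_sub_right] at h
      simp only [ContinuousLinearMap.coe_coe]
      linear_combination -h
    · intro w
      have h := re_inner_nonneg_of_mem_graph hG (hRg w)
      rw [inner_sub_right, Complex.sub_re, re_inner_self] at h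
      rw [ContinuousLinearMap.reApplyInnerSelf_apply]
      have h3 := sq_nonneg ‖R w‖
      simp only [RCLike.re_to_complex]
      linarith
  · refine ContinuousLinearMap.opNorm_le_bound _ zero_le_one fun w => ?_
    have := norm_le_norm_add_of_mem_graph hG (hRg w)
    simpa using this
  · intro x y
    constructor
    · intro h
      have : e.symm (x + y) = ⟨(x, y), h⟩ := by
        rw [ContinuousLinearEquiv.symm_apply_eq]; rfl
      rw [hR, this]
    · intro h
      have h2 := hRg (x + y)
      rw [h] at h2
      simpa using h2

namespace IsResolvent

variable {G : H →ₗ.[ℂ] H} {R : H →L[ℂ] H}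

theorem isSelfAdjoint (hR : IsResolvent G R) : IsSelfAdjoint R := hR.isPositive.isSelfAdjoint

theorem mem_graph (hR : IsResolvent G R) (w : H) : (R w, w - R w) ∈ G.graph := by
  rw [hR.mem_graph_iff]; simp

theorem inner_left (hR : IsResolvent G R) (x y : H) : ⟪R x, y⟫_ℂ = ⟪x, R y⟫_ℂ :=
  hR.isPositive.isSymmetric x y

theorem eq_zero_of_apply_eq_zero (hR : IsResolvent G R) {w : H} (h : R w = 0) : w = 0 := by
  have := hR.mem_graph w
  rw [h] at this
  simpa using LinearPMap.graph_fst_eq_zero_snd _ this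

theorem dense_range (hR : IsResolvent G R) : Dense (Set.range R) := by
  have h : (LinearMap.range R.toLinearMap).topologicalClosure = ⊤ := by
    rw [Submodule.topologicalClosure_eq_top_iff, Submodule.eq_bot_iff]
    intro w hw
    rw [Submodule.mem_orthogonal'] at hw
    apply hR.eq_zero_of_apply_eq_zero
    rw [← inner_self_eq_zero (𝕜 := ℂ), hR.inner_left]
    exact hw _ ⟨R w, rfl⟩
  exact (Submodule.dense_iff_topologicalClosure_eq_top
    (s := LinearMap.range R.toLinearMap)).mpr h

theorem spectrum_subset (hR : IsResolvent G R) : spectrum ℝ R ⊆ Set.Icc 0 1 := by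
  intro r hr
  refine ⟨?_, ?_⟩
  · exact spectrum_nonneg_of_nonneg
      ((ContinuousLinearMap.nonneg_iff_isPositive R).mpr hR.isPositive) hr
  · have h1 : ‖r‖ ≤ ‖R‖ * ‖(1 : H →L[ℂ] H)‖ := spectrum.norm_le_norm_mul_of_mem hr
    have h2 : ‖(1 : H →L[ℂ] H)‖ ≤ 1 := ContinuousLinearMap.norm_id_le
    have := hR.norm_le
    have h3 : ‖R‖ * ‖(1 : H →L[ℂ] H)‖ ≤ 1 := mul_le_one₀ this (norm_nonneg _) h2
    exact (le_abs_self r).trans (h1.trans h3)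

end IsResolvent

/-- Since G = (1 − R)R⁻¹, the root is formally D C⁻¹ with C = √R and D = √(1 − R). Its graph is
taken to be {(Cw, Dw)}, so no unbounded inverse appears. -/
theorem exists_isPositiveSqrt {G : H →ₗ.[ℂ] H} (hG : IsPositiveSelfAdjoint G) :
    ∃ S : H →ₗ.[ℂ] H, IsPositiveSqrt S G := by
  obtain ⟨R, hR⟩ := exists_isResolvent hG
  have hRsa := hR.isSelfAdjoint
  set C : H →L[ℂ] H := cfc (fun r : ℝ => √r) R with hC
  set D : H →L[ℂ] H := cfc (fun r : ℝ => √(1 - r)) R with hD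
  have hCC : C * C = R := by
    rw [hC, ← cfc_mul _ _ R]
    conv_rhs => rw [← cfc_id ℝ R]
    exact cfc_congr fun r hr => Real.mul_self_sqrt (hR.spectrum_subset hr).1
  have hDD : D * D = 1 - R := by
    rw [hD, ← cfc_mul _ _ R]
    have h1 : (1 : H →L[ℂ] H) - R = cfc (fun r : ℝ => 1 - r) R := by
      rw [cfc_sub (fun _ => (1 : ℝ)) (fun r => r) R, cfc_const_one ℝ R, cfc_id' ℝ R]
    rw [h1]
    exact cfc_congr fun r hr => Real.mul_self_sqrt (by linarith [(hR.spectrum_subset hr).2])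
  have hCD : C * D = D * C := cfc_commute_cfc _ _ R
  have hCs : ∀ x y, ⟪C x, y⟫_ℂ = ⟪x, C y⟫_ℂ :=
    ContinuousLinearMap.isSelfAdjoint_iff_isSymmetric.mp (cfc_predicate (fun r : ℝ => √r) R)
  have hDs : ∀ x y, ⟪D x, y⟫_ℂ = ⟪x, D y⟫_ℂ :=
    ContinuousLinearMap.isSelfAdjoint_iff_isSymmetric.mp (cfc_predicate (fun r : ℝ => √(1 - r)) R)
  have hCC' : ∀ x, C (C x) = R x := fun x => congrArg (fun T : H →L[ℂ] H => T x) hCC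
  have hDD' : ∀ x, D (D x) = x - R x := fun x => congrArg (fun T : H →L[ℂ] H => T x) hDD
  have hCD' : ∀ x, C (D x) = D (C x) := fun x => congrArg (fun T : H →L[ℂ] H => T x) hCD
  have hCinj : ∀ x, C x = 0 → x = 0 := fun x hx =>
    hR.eq_zero_of_apply_eq_zero (by rw [← hCC', hx, map_zero])
  -- From C² + D² = 1 and commutation: u = C²u + D²u = C(Cu) + D(Cv).
  have hsolve : ∀ u v, D u = C v → u = C (C u + D v) := by
    intro u v h
    rw [map_add, hCC', hCD', ← h, hDD']; abel
  have hg : ∀ z ∈ LinearMap.range (C.prod D).toLinearMap, z.1 = 0 → z.2 = 0 := by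
    rintro _ ⟨y, rfl⟩ h
    have : y = 0 := hCinj y h
    simp [this]
  let S : H →ₗ.[ℂ] H := (LinearMap.range (C.prod D).toLinearMap).toLinearPMap
  have hS : ∀ x y, (x, y) ∈ S.graph ↔ ∃ w, C w = x ∧ D w = y := by
    intro x y
    rw [Submodule.toLinearPMap_graph_eq _ hg]
    constructor
    · rintro ⟨w, hw⟩
      exact ⟨w, congrArg Prod.fst hw, congrArg Prod.snd hw⟩
    · rintro ⟨w, rfl, rfl⟩
      exact ⟨w, rfl⟩
  have hSsa : IsSelfAdjoint S := by
    apply isSelfAdjoint_of_graph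
    · apply hR.dense_range.mono
      rintro _ ⟨w, rfl⟩
      exact LinearPMap.mem_domain_of_mem_graph ((hS (R w) (D (C w))).mpr ⟨C w, hCC' w, rfl⟩)
    · intro x y x' y' h h'
      obtain ⟨w, rfl, rfl⟩ := (hS x y).mp h
      obtain ⟨w', rfl, rfl⟩ := (hS x' y').mp h'
      rw [hDs, hCs, hCD']
    -- Maximality: testing against the pairs (Cz, Dz) says exactly Du = Cv, and then w = Cu + Dv
    -- parametrises (u, v).
    · intro u v h
      have h1 : D u = C v := by
        refine ext_inner_right ℂ fun z => ?_
        rw [hDs, hCs]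
        exact (h (C z) (D z) ((hS _ _).mpr ⟨z, rfl, rfl⟩)).symm
      refine (hS u v).mpr ⟨C u + D v, (hsolve u v h1).symm, ?_⟩
      have h2 := congrArg D (hsolve u v h1)
      rw [h1, ← hCD'] at h2
      exact (sub_eq_zero.mp (hCinj _ (by rw [map_sub, h2, sub_self])))
  refine ⟨S, ⟨hSsa, ?_⟩, ?_⟩
  · intro x
    obtain ⟨w, hw1, hw2⟩ := (hS _ _).mp (S.mem_graph x)
    rw [← hw1, ← hw2, hCs]
    have hpos : 0 ≤ C * D := by
      rw [hC, hD, ← cfc_mul _ _ R]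
      exact cfc_nonneg fun r _ => mul_nonneg (Real.sqrt_nonneg _) (Real.sqrt_nonneg _)
    rw [ContinuousLinearMap.nonneg_iff_isPositive] at hpos
    exact hpos.re_inner_nonneg_right w
  · intro x y
    rw [hR.mem_graph_iff]
    constructor
    · intro h
      -- With s = x + y one has x = C(Cs), y = D(Ds), and the intermediate vector is DCs = CDs.
      refine ⟨D (C (x + y)), (hS _ _).mpr ⟨C (x + y), ?_, rfl⟩, (hS _ _).mpr ⟨D (x + y), ?_, ?_⟩⟩
      · rw [hCC', h]
      · rw [hCD']
      · rw [hDD', h]; abel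
    · rintro ⟨z, h1, h2⟩
      obtain ⟨w, rfl, rfl⟩ := (hS _ _).mp h1
      obtain ⟨v, hv, rfl⟩ := (hS _ _).mp h2
      have h3 := hsolve w v hv.symm
      have h4 : D (C w + D v) = v := by
        have h2 := congrArg D h3
        rw [← hv, ← hCD'] at h2
        exact (sub_eq_zero.mp (hCinj _ (by rw [map_sub, h2, sub_self])))
      have h5 : C w + D v = R (C w + D v) + D (D (C w + D v)) := by rw [hDD']; abel
      rw [h4] at h5
      have h6 : C w = R (C w + D v) := by simpa using h5
      rw [← h6]

end SelfAdjoint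
-- Measures representing f ↦ ⟨x|f(R)|x⟩, and kernels of f(R).
section VectorMeasure

set_option linter.unusedSectionVars false

open MeasureTheory Filter Topology Set

variable {H : Type*} [NormedAddCommGroup H] [InnerProductSpace ℂ H] [CompleteSpace H]

/-- `ν` represents the functional `f ↦ ⟨x|f(R)|x⟩` on continuous functions, for an operator `R`
whose spectrum lies in `[0, 1]`. -/
structure IsVectorMeasure (R : H →L[ℂ] H) (x : H) (ν : Measure ℝ) : Prop where
  finite : IsFiniteMeasure ν
  ae_mem : ∀ᵐ r ∂ν, r ∈ Icc (0 : ℝ) 1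
  integral_eq : ∀ f : ℝ → ℝ, Continuous f → ∫ r, f r ∂ν = (⟪x, cfc f R x⟫_ℂ).re

theorem inner_cfc_left (R : H →L[ℂ] H) (f : ℝ → ℝ) (x y : H) :
    ⟪cfc f R x, y⟫_ℂ = ⟪x, cfc f R y⟫_ℂ :=
  ContinuousLinearMap.isSelfAdjoint_iff_isSymmetric.mp (cfc_predicate f R) x y

theorem cfc_apply_cfc_apply (R : H →L[ℂ] H) {f g : ℝ → ℝ} (hf : Continuous f) (hg : Continuous g)
    (x : H) : cfc f R (cfc g R x) = cfc (fun r => f r * g r) R x := by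
  rw [cfc_mul f g R hf.continuousOn hg.continuousOn]; rfl

/-- Riesz–Markov for the positive functional f ↦ ⟨x, f(R)x⟩ on the compact spectrum, pushed forward
to ℝ. -/
theorem exists_isVectorMeasure {R : H →L[ℂ] H} (hR : IsSelfAdjoint R)
    (hs : spectrum ℝ R ⊆ Icc 0 1) (x : H) : ∃ ν, IsVectorMeasure R x ν := by
  have hcomp : CompactSpace (spectrum ℝ R) :=
    ContinuousFunctionalCalculus.compactSpace_spectrum (p := IsSelfAdjoint) R
  let L : CompactlySupportedContinuousMap (spectrum ℝ R) ℝ →ₗ[ℝ] ℝ :=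
    { toFun := fun f => (⟪x, cfcHom (p := IsSelfAdjoint) hR (f : C(spectrum ℝ R, ℝ)) x⟫_ℂ).re
      map_add' := fun f g => by
        have : ((f + g : CompactlySupportedContinuousMap (spectrum ℝ R) ℝ) : C(spectrum ℝ R, ℝ))
          = (f : C(spectrum ℝ R, ℝ)) + (g : C(spectrum ℝ R, ℝ)) := rfl
        rw [this, map_add, add_apply, inner_add_right, Complex.add_re]
      map_smul' := fun c f => by
        have : ((c • f : CompactlySupportedContinuousMap (spectrum ℝ R) ℝ) : C(spectrum ℝ R, ℝ))
          = c • (f : C(spectrum ℝ R, ℝ)) := rfl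
        rw [this, map_smul, smul_apply]
        rw [show c • (cfcHom (p := IsSelfAdjoint) hR (f : C(spectrum ℝ R, ℝ))) x
          = (c : ℂ) • (cfcHom (p := IsSelfAdjoint) hR (f : C(spectrum ℝ R, ℝ))) x from
          (Complex.coe_smul _ _).symm, inner_smul_right, Complex.re_ofReal_mul]
        rfl }
  let Λ : CompactlySupportedContinuousMap (spectrum ℝ R) ℝ →ₚ[ℝ] ℝ :=
    PositiveLinearMap.mk₀ L fun f hf => by
      have h1 : 0 ≤ cfcHom (p := IsSelfAdjoint) hR (f : C(spectrum ℝ R, ℝ)) :=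
        cfcHom_nonneg_iff (p := IsSelfAdjoint) hR |>.mpr fun r => hf r
      exact ((ContinuousLinearMap.nonneg_iff_isPositive _).mp h1).re_inner_nonneg_right x
  have hΛ : ∀ f, Λ f = (⟪x, cfcHom (p := IsSelfAdjoint) hR (f : C(spectrum ℝ R, ℝ)) x⟫_ℂ).re :=
    fun f => rfl
  let ν₀ := RealRMK.rieszMeasure Λ
  have hfin : IsFiniteMeasure ν₀ := by
    refine ⟨lt_of_le_of_lt (RealRMK.rieszMeasure_le_of_eq_one Λ
      (f := CompactlySupportedContinuousMap.continuousMapEquiv 1) (fun _ => zero_le_one)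
      isCompact_univ (fun _ _ => rfl)) ENNReal.ofReal_lt_top⟩
  have hemb : MeasurableEmbedding (Subtype.val : spectrum ℝ R → ℝ) :=
    MeasurableEmbedding.subtype_coe (spectrum.isClosed R).measurableSet
  refine ⟨ν₀.map Subtype.val, ⟨inferInstance, ?_, ?_⟩⟩
  · rw [hemb.ae_map_iff]
    exact Filter.Eventually.of_forall fun r => hs r.2
  · intro f hf
    rw [hemb.integral_map]
    let g : C(spectrum ℝ R, ℝ) := ⟨fun r => f r, hf.comp continuous_subtype_val⟩
    have h := RealRMK.integral_rieszMeasure Λ (CompactlySupportedContinuousMap.continuousMapEquiv g)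
    rw [hΛ] at h
    rw [cfc_apply f R hR hf.continuousOn]
    exact h

namespace IsVectorMeasure

variable {R : H →L[ℂ] H} {x : H} {ν : Measure ℝ}

theorem integrable (h : IsVectorMeasure R x ν) {f : ℝ → ℝ} (hf : Continuous f) :
    Integrable f ν := by
  have := h.finite
  obtain ⟨C, hC⟩ := isCompact_Icc.exists_bound_of_continuousOn (s := Icc (0 : ℝ) 1)
    hf.continuousOn
  exact Integrable.of_bound hf.aestronglyMeasurable C (h.ae_mem.mono fun r hr => hC r hr)

theorem norm_cfc_sq (h : IsVectorMeasure R x ν) {f : ℝ → ℝ} (hf : Continuous f) :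
    ‖cfc f R x‖ ^ 2 = ∫ r, f r ^ 2 ∂ν := by
  rw [h.integral_eq (fun r => f r ^ 2) (hf.pow 2), ← re_inner_self, inner_cfc_left,
    cfc_apply_cfc_apply R hf hf]
  simp_rw [sq]

theorem measureReal_univ (hR : IsSelfAdjoint R) (h : IsVectorMeasure R x ν) :
    ν.real univ = ‖x‖ ^ 2 := by
  have := h.norm_cfc_sq (f := fun _ => 1) continuous_const
  rw [cfc_const_one ℝ R] at this
  simpa using this.symm

end IsVectorMeasure

/-- Continuous approximations of the indicator function of the zero set of `f`. -/
noncomputable def zeroCutoff (f : ℝ → ℝ) (n : ℕ) (r : ℝ) : ℝ :=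
  1 - (max (f r) (1 / ((n : ℝ) + 1)))⁻¹ * f r

theorem continuous_inv_max {f : ℝ → ℝ} (hf : Continuous f) (n : ℕ) :
    Continuous fun r => (max (f r) (1 / ((n : ℝ) + 1)))⁻¹ := by
  refine (hf.max continuous_const).inv₀ fun r => ?_
  have : (0 : ℝ) < 1 / ((n : ℝ) + 1) := by positivity
  exact (lt_max_of_lt_right this).ne'

theorem continuous_zeroCutoff {f : ℝ → ℝ} (hf : Continuous f) (n : ℕ) :
    Continuous (zeroCutoff f n) :=
  continuous_const.sub ((continuous_inv_max hf n).mul hf)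

theorem zeroCutoff_bounds {f : ℝ → ℝ} {r : ℝ} (hf : 0 ≤ f r) (n : ℕ) :
    0 ≤ zeroCutoff f n r ∧ zeroCutoff f n r ≤ 1 ∧ zeroCutoff f n r * f r ≤ 1 / ((n : ℝ) + 1) := by
  have h0 : (0 : ℝ) < 1 / ((n : ℝ) + 1) := by positivity
  have h1 : 0 < max (f r) (1 / ((n : ℝ) + 1)) := lt_max_of_lt_right h0
  have h2 : (max (f r) (1 / ((n : ℝ) + 1)))⁻¹ * f r ≤ 1 := by
    rw [inv_mul_le_iff₀ h1]; simp
  have h3 : 0 ≤ (max (f r) (1 / ((n : ℝ) + 1)))⁻¹ * f r := by positivity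
  refine ⟨by unfold zeroCutoff; linarith, by unfold zeroCutoff; linarith, ?_⟩
  rcases le_total (f r) (1 / ((n : ℝ) + 1)) with h | h
  · unfold zeroCutoff
    nlinarith
  · have h4 : zeroCutoff f n r = 0 := by
      unfold zeroCutoff
      rw [max_eq_left h, inv_mul_cancel₀ (by linarith), sub_self]
    rw [h4]; simpa using h0.le

theorem tendsto_zeroCutoff {f : ℝ → ℝ} {r : ℝ} (hf : 0 ≤ f r) :
    Tendsto (fun n => zeroCutoff f n r) atTop
      (𝓝 (indicator {r | f r = 0} (fun _ => (1 : ℝ)) r)) := by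
  rcases hf.eq_or_lt with h | h
  · rw [indicator_of_mem (show r ∈ {r | f r = 0} from h.symm)]
    have : ∀ n, zeroCutoff f n r = 1 := fun n => by simp [zeroCutoff, ← h]
    simp [this]
  · rw [indicator_of_notMem (show r ∉ {r | f r = 0} from h.ne')]
    refine squeeze_zero (fun n => (zeroCutoff_bounds hf n).1)
      (g := fun n : ℕ => 1 / ((n : ℝ) + 1) * (f r)⁻¹) (fun n => ?_) ?_
    · rw [← div_eq_mul_inv, le_div_iff₀ h]; exact (zeroCutoff_bounds hf n).2.2
    · simpa using tendsto_one_div_add_atTop_nhds_zero_nat.mul_const (f r)⁻¹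

/-- The operators `zeroCutoff f n (R)` converge strongly to the projection onto `ker f(R)`. -/
theorem tendsto_cfc_zeroCutoff {R : H →L[ℂ] H} (hR : IsSelfAdjoint R) {f : ℝ → ℝ}
    (hf : Continuous f) (hf0 : ∀ r, 0 ≤ f r) (x : H) :
    Tendsto (fun n => cfc (zeroCutoff f n) R x) atTop
      (𝓝 ((cfc f R).ker.starProjection x)) := by
  set K := (cfc f R).ker
  have hnorm : ∀ n y, ‖cfc (zeroCutoff f n) R y‖ ≤ ‖y‖ := by
    intro n y
    have h : ‖cfc (zeroCutoff f n) R‖ ≤ 1 := norm_cfc_le zero_le_one fun r _ => by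
      rw [Real.norm_of_nonneg (zeroCutoff_bounds (hf0 r) n).1]
      exact (zeroCutoff_bounds (hf0 r) n).2.1
    simpa using (cfc (zeroCutoff f n) R).le_of_opNorm_le h y
  have hker : ∀ n, ∀ y ∈ K, cfc (zeroCutoff f n) R y = y := by
    intro n y hy
    have h1 : cfc (zeroCutoff f n) R
        = 1 - cfc (fun r => (max (f r) (1 / ((n : ℝ) + 1)))⁻¹) R * cfc f R := by
      rw [← cfc_mul _ f R (continuous_inv_max hf n).continuousOn hf.continuousOn,
        ← cfc_const_one ℝ R, ← cfc_sub (fun _ => (1 : ℝ))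
          (fun r => (max (f r) (1 / ((n : ℝ) + 1)))⁻¹ * f r) R continuous_const.continuousOn
          ((continuous_inv_max hf n).mul hf).continuousOn]
      rfl
    have h2 : cfc f R y = 0 := hy
    rw [h1, sub_apply, mul_apply_eq_comp, h2]
    simp
  have hrange : ∀ n z, ‖cfc (zeroCutoff f n) R (cfc f R z)‖ ≤ 1 / ((n : ℝ) + 1) * ‖z‖ := by
    intro n z
    rw [cfc_apply_cfc_apply R (continuous_zeroCutoff hf n) hf]
    refine ContinuousLinearMap.le_of_opNorm_le _ (norm_cfc_le (by positivity) fun r _ => ?_) z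
    rw [Real.norm_of_nonneg (mul_nonneg (zeroCutoff_bounds (hf0 r) n).1 (hf0 r))]
    exact (zeroCutoff_bounds (hf0 r) n).2.2
  -- The complement of ker f(R) is the closure of the range of f(R). On the range the cut-offs decay
  -- like 1/(n+1), and they are contractions, so the decay extends to the closure.
  have hort : ∀ w ∈ Kᗮ, Tendsto (fun n => cfc (zeroCutoff f n) R w) atTop (𝓝 0) := by
    intro w hw
    have hsa : (cfc f R).adjoint = cfc f R :=
      ContinuousLinearMap.isSelfAdjoint_iff'.mp (cfc_predicate f R)
    rw [ContinuousLinearMap.orthogonal_ker, hsa] at hw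
    rw [Metric.tendsto_atTop]
    intro ε hε
    obtain ⟨_, ⟨z, rfl⟩, hz⟩ := Metric.mem_closure_iff.mp hw (ε / 2) (half_pos hε)
    have hlim : Tendsto (fun n : ℕ => 1 / ((n : ℝ) + 1) * ‖z‖) atTop (𝓝 0) := by
      simpa using tendsto_one_div_add_atTop_nhds_zero_nat.mul_const ‖z‖
    obtain ⟨N, hN⟩ := (hlim.eventually (gt_mem_nhds (half_pos hε))).exists_forall_of_atTop
    refine ⟨N, fun n hn => ?_⟩
    rw [dist_zero_right]
    have hdec : cfc (zeroCutoff f n) R w = cfc (zeroCutoff f n) R (w - cfc f R z)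
        + cfc (zeroCutoff f n) R (cfc f R z) := by rw [← map_add, sub_add_cancel]
    rw [hdec]
    have h1 := hnorm n (w - cfc f R z)
    rw [dist_eq_norm] at hz
    have h2 := hrange n z
    have h3 := hN n hn
    have hz' : ‖w - cfc f R z‖ < ε / 2 := hz
    exact (norm_add_le _ _).trans_lt (by linarith)
  have hx : ∀ n, cfc (zeroCutoff f n) R x
      = K.starProjection x + cfc (zeroCutoff f n) R (x - K.starProjection x) := by
    intro n
    rw [map_sub, hker n _ (K.starProjection_apply_mem x)]
    abel
  simp_rw [hx]
  simpa using tendsto_const_nhds.add (hort _ (K.sub_starProjection_mem_orthogonal x))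

/-- Both sides are limits of ∫ `zeroCutoff`. This turns masses of zero sets into projections using
only the continuous functional calculus. -/
theorem IsVectorMeasure.measureReal_zeros {R : H →L[ℂ] H} (hR : IsSelfAdjoint R) {x : H}
    {ν : Measure ℝ} (h : IsVectorMeasure R x ν) {f : ℝ → ℝ} (hf : Continuous f)
    (hf0 : ∀ r, 0 ≤ f r) : ν.real {r | f r = 0} = ‖(cfc f R).ker.starProjection x‖ ^ 2 := by
  have := h.finite
  have h1 : Tendsto (fun n => ∫ r, zeroCutoff f n r ∂ν) atTop
      (𝓝 (∫ r, indicator {r | f r = 0} (fun _ => (1 : ℝ)) r ∂ν)) := by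
    refine tendsto_integral_of_dominated_convergence (fun _ => 1)
      (fun n => (continuous_zeroCutoff hf n).aestronglyMeasurable) (integrable_const _)
      (fun n => Eventually.of_forall fun r => ?_)
      (Eventually.of_forall fun r => tendsto_zeroCutoff (hf0 r))
    rw [Real.norm_of_nonneg (zeroCutoff_bounds (hf0 r) n).1]
    exact (zeroCutoff_bounds (hf0 r) n).2.1
  have hmeas : MeasurableSet {r | f r = 0} := (isClosed_eq hf continuous_const).measurableSet
  rw [integral_indicator_const _ hmeas, smul_eq_mul, mul_one] at h1
  have h2 : Tendsto (fun n => ∫ r, zeroCutoff f n r ∂ν) atTop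
      (𝓝 (⟪x, (cfc f R).ker.starProjection x⟫_ℂ).re) := by
    simp_rw [h.integral_eq _ (continuous_zeroCutoff hf _)]
    exact (Complex.continuous_re.tendsto _).comp
      (tendsto_const_nhds.inner (tendsto_cfc_zeroCutoff hR hf hf0 x))
  rw [tendsto_nhds_unique h1 h2, ← re_inner_self,
    Submodule.inner_starProjection_left_eq_right]
  congr 2
  exact (Submodule.starProjection_eq_self_iff.mpr (Submodule.starProjection_apply_mem _ x)).symm

end VectorMeasure
-- The spectral family of G, built from its resolvent.
section SpectralFamily

set_option linter.unusedSectionVars false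

open MeasureTheory Filter Topology Set

variable {H : Type*} [NormedAddCommGroup H] [InnerProductSpace ℂ H] [CompleteSpace H]

theorem SpectralFamily.measure_Iic (E : SpectralFamily H) (x : H) (t : ℝ) :
    E.measure x (Iic t) = ENNReal.ofReal (‖E.proj t x‖ ^ 2) := by
  have h : Tendsto (E.distribution x) atBot (𝓝 0) := by
    have := ((E.tendsto_atBot x).norm.pow 2)
    rw [norm_zero, zero_pow two_ne_zero] at this
    exact this
  have h2 := StieltjesFunction.measure_Iic (E.distribution x) h t
  rw [sub_zero] at h2
  exact h2

theorem SpectralFamily.isFiniteMeasure (E : SpectralFamily H) (x : H) :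
    IsFiniteMeasure (E.measure x) := by
  have h : Tendsto (E.distribution x) atBot (𝓝 0) := by
    have := ((E.tendsto_atBot x).norm.pow 2)
    rw [norm_zero, zero_pow two_ne_zero] at this
    exact this
  have h' : Tendsto (E.distribution x) atTop (𝓝 (‖x‖ ^ 2)) := (E.tendsto_atTop x).norm.pow 2
  constructor
  have h2 := StieltjesFunction.measure_univ (E.distribution x) h h'
  exact h2 ▸ ENNReal.ofReal_lt_top

/-- The function of the resolvent whose kernel is the range of the spectral projector of `G` for
`(-∞, t]`. -/
noncomputable def thresholdFun (t r : ℝ) : ℝ := max 0 (1 - (1 + t) * r)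

theorem continuous_thresholdFun (t : ℝ) : Continuous (thresholdFun t) := by
  unfold thresholdFun; fun_prop

theorem thresholdFun_nonneg (t r : ℝ) : 0 ≤ thresholdFun t r := le_max_left _ _

/-- The spectral projectors of `G`, in terms of its resolvent `R`. -/
noncomputable def resolventProj (R : H →L[ℂ] H) (t : ℝ) : H →L[ℂ] H :=
  (cfc (thresholdFun t) R).ker.starProjection

namespace IsResolvent

variable {G : H →ₗ.[ℂ] H} {R : H →L[ℂ] H}

theorem exists_isVectorMeasure (hR : IsResolvent G R) (x : H) : ∃ ν, IsVectorMeasure R x ν :=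
  EnergyNorm.exists_isVectorMeasure hR.isSelfAdjoint hR.spectrum_subset x

/-- The cut-off lemmas need a function that is nonnegative on all of ℝ; |r| replaces r, with which
it agrees on the spectrum. -/
theorem cfc_abs_eq (hR : IsResolvent G R) : cfc (fun r : ℝ => |r|) R = R := by
  have h := hR.isSelfAdjoint
  conv_rhs => rw [← cfc_id ℝ R]
  exact cfc_congr fun r hr => abs_of_nonneg (hR.spectrum_subset hr).1

theorem starProjection_ker_abs (hR : IsResolvent G R) (x : H) :
    (cfc (fun r : ℝ => |r|) R).ker.starProjection x = 0 := by
  apply hR.eq_zero_of_apply_eq_zero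
  have h := Submodule.starProjection_apply_mem (cfc (fun r : ℝ => |r|) R).ker x
  have h2 : cfc (fun r : ℝ => |r|) R ((cfc (fun r : ℝ => |r|) R).ker.starProjection x) = 0 := h
  rwa [hR.cfc_abs_eq] at h2 ⊢

theorem ae_mem_Ioc (hR : IsResolvent G R) {x : H} {ν : Measure ℝ} (h : IsVectorMeasure R x ν) :
    ∀ᵐ r ∂ν, r ∈ Ioc (0 : ℝ) 1 := by
  have := h.finite
  have h0 := h.measureReal_zeros hR.isSelfAdjoint continuous_abs abs_nonneg
  rw [hR.starProjection_ker_abs, norm_zero, zero_pow two_ne_zero, measureReal_eq_zero_iff] at h0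
  have h1 : ∀ᵐ r ∂ν, ¬ |r| = 0 := by rw [ae_iff]; simpa using h0
  filter_upwards [h1, h.ae_mem] with r hr hr2
  exact ⟨lt_of_le_of_ne hr2.1 fun h => hr (by simp [← h]), hr2.2⟩

/-- The spectral variables are related by λ = r⁻¹ − 1. For r > 0 the condition λ ≤ t says 1 − (1 +
t)r ≤ 0, the zero set of `thresholdFun t`; the point r = 0 carries no mass because R is injective.
-/
theorem norm_resolventProj_sq (hR : IsResolvent G R) {x : H} {ν : Measure ℝ}
    (h : IsVectorMeasure R x ν) (t : ℝ) :
    (ν.map fun r => r⁻¹ - 1).real (Iic t) = ‖resolventProj R t x‖ ^ 2 := by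
  have hm : Measurable fun r : ℝ => r⁻¹ - 1 := measurable_inv.sub_const 1
  rw [map_measureReal_apply hm measurableSet_Iic, resolventProj,
    ← h.measureReal_zeros hR.isSelfAdjoint (continuous_thresholdFun t) (thresholdFun_nonneg t)]
  apply measureReal_congr
  filter_upwards [hR.ae_mem_Ioc h] with r hr
  apply propext
  show r⁻¹ - 1 ≤ t ↔ max 0 (1 - (1 + t) * r) = 0
  rw [max_eq_left_iff, sub_le_iff_le_add, inv_le_iff_one_le_mul₀ hr.1]
  constructor <;> intro h <;> linarith

theorem ker_threshold_le (hR : IsResolvent G R) {s t : ℝ} (hst : s ≤ t) :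
    (cfc (thresholdFun s) R).ker ≤ (cfc (thresholdFun t) R).ker := by
  intro x hx
  obtain ⟨ν, hν⟩ := hR.exists_isVectorMeasure x
  have hx' : cfc (thresholdFun s) R x = 0 := hx
  have h1 := hν.norm_cfc_sq (continuous_thresholdFun s)
  have h2 := hν.norm_cfc_sq (continuous_thresholdFun t)
  have h3 : ∫ r, thresholdFun t r ^ 2 ∂ν ≤ ∫ r, thresholdFun s r ^ 2 ∂ν := by
    refine integral_mono_ae (hν.integrable ((continuous_thresholdFun t).pow 2))
      (hν.integrable ((continuous_thresholdFun s).pow 2)) ?_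
    filter_upwards [hν.ae_mem] with r hr
    have : thresholdFun t r ≤ thresholdFun s r :=
      max_le_max le_rfl (by nlinarith [hr.1])
    have := thresholdFun_nonneg t r
    exact pow_le_pow_left₀ this ‹_› 2
  rw [← h1, ← h2, hx', norm_zero, zero_pow two_ne_zero] at h3
  have h4 : ‖cfc (thresholdFun t) R x‖ = 0 := by
    have := le_antisymm h3 (sq_nonneg _)
    simpa using this
  exact norm_eq_zero.mp h4

theorem resolventProj_apply (hR : IsResolvent G R) {s t : ℝ} (hst : s ≤ t) (x : H) :
    resolventProj R s (resolventProj R t x) = resolventProj R s x :=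
  congrArg (fun T : H →L[ℂ] H => T x)
    (Submodule.starProjection_comp_starProjection_of_le (hR.ker_threshold_le hst))

/-- The spectral family of a positive self-adjoint operator, constructed from its resolvent. -/
noncomputable def spectralFamily (hR : IsResolvent G R) : SpectralFamily H where
  proj := resolventProj R
  isStarProjection t := isStarProjection_starProjection
  mul_eq_of_le s t hst := ContinuousLinearMap.ext fun x => hR.resolventProj_apply hst x
  right_continuous x t := by
    obtain ⟨ν, hν⟩ := hR.exists_isVectorMeasure x
    have := hν.finite
    rw [← continuousWithinAt_Ioi_iff_Ici]
    have h1 := tendsto_measure_biInter_gt (μ := ν.map fun r => r⁻¹ - 1) (s := Iic) (a := t)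
      (fun r _ => nullMeasurableSet_Iic) (fun i j _ hij => Iic_subset_Iic.mpr hij)
      ⟨t + 1, by simp, measure_ne_top _ _⟩
    have h2 : ⋂ r > t, Iic r = Iic t := by
      ext y; simp only [mem_iInter, mem_Iic]
      exact ⟨fun h => le_of_forall_gt_imp_ge_of_dense h, fun h r hr => h.trans (le_of_lt hr)⟩
    rw [h2] at h1
    have h3 : Tendsto (fun s => ‖resolventProj R s x‖ ^ 2) (𝓝[>] t)
        (𝓝 (‖resolventProj R t x‖ ^ 2)) := by
      simp_rw [← hR.norm_resolventProj_sq hν]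
      exact (ENNReal.tendsto_toReal (measure_ne_top _ _)).comp h1
    rw [ContinuousWithinAt, tendsto_iff_norm_sub_tendsto_zero]
    -- For nested projections Pythagoras gives ‖P_s x − P_t x‖² = ‖P_s x‖² − ‖P_t x‖², so continuity
    -- of the scalar distribution function suffices.
    have h4 : Tendsto (fun s => √(‖resolventProj R s x‖ ^ 2 - ‖resolventProj R t x‖ ^ 2)) (𝓝[>] t)
        (𝓝 0) := by
      have := (h3.sub_const (‖resolventProj R t x‖ ^ 2)).sqrt
      simpa using this
    refine h4.congr' ?_
    filter_upwards [self_mem_nhdsWithin] with s hs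
    have h5 := (cfc (thresholdFun t) R).ker.norm_sq_eq_add_norm_sq_starProjection
      (resolventProj R s x)
    have h6 := hR.resolventProj_apply (le_of_lt hs) x
    rw [Submodule.starProjection_orthogonal_val] at h5
    rw [show (cfc (thresholdFun t) R).ker.starProjection = resolventProj R t from rfl, h6] at h5
    rw [h5, add_sub_cancel_left, Real.sqrt_sq (norm_nonneg _)]
  tendsto_atBot x := by
    obtain ⟨ν, hν⟩ := hR.exists_isVectorMeasure x
    have := hν.finite
    have h1 := tendsto_measure_iInter_atBot (μ := ν.map fun r => r⁻¹ - 1) (s := fun t : ℝ => Iic t)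
      (fun t => nullMeasurableSet_Iic) monotone_Iic ⟨0, measure_ne_top _ _⟩
    rw [iInter_Iic_eq_empty_iff.mpr (by simp), measure_empty] at h1
    have h3 : Tendsto (fun s => ‖resolventProj R s x‖ ^ 2) atBot (𝓝 0) := by
      simp_rw [← hR.norm_resolventProj_sq hν]
      exact (ENNReal.tendsto_toReal ENNReal.zero_ne_top).comp h1
    rw [tendsto_zero_iff_norm_tendsto_zero]
    have := h3.sqrt
    simpa [Real.sqrt_sq (norm_nonneg _)] using this
  tendsto_atTop x := by
    obtain ⟨ν, hν⟩ := hR.exists_isVectorMeasure x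
    have := hν.finite
    have hm : Measurable fun r : ℝ => r⁻¹ - 1 := measurable_inv.sub_const 1
    have h1 := tendsto_measure_Iic_atTop (ν.map fun r => r⁻¹ - 1)
    have h3 : Tendsto (fun s => ‖resolventProj R s x‖ ^ 2) atTop (𝓝 (‖x‖ ^ 2)) := by
      simp_rw [← hR.norm_resolventProj_sq hν]
      have h4 := (ENNReal.tendsto_toReal (measure_ne_top (ν.map fun r => r⁻¹ - 1) univ)).comp h1
      rw [← hν.measureReal_univ hR.isSelfAdjoint]
      have h5 : (ν.map fun r => r⁻¹ - 1) univ = ν univ := by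
        rw [Measure.map_apply hm MeasurableSet.univ]; rfl
      rw [h5] at h4
      exact h4
    rw [tendsto_iff_norm_sub_tendsto_zero]
    have h4 : Tendsto (fun s => √(‖x‖ ^ 2 - ‖resolventProj R s x‖ ^ 2)) atTop (𝓝 0) := by
      have := (h3.const_sub (‖x‖ ^ 2)).sqrt
      simpa using this
    refine h4.congr fun s => ?_
    have h5 := (cfc (thresholdFun s) R).ker.norm_sq_eq_add_norm_sq_starProjection x
    rw [Submodule.starProjection_orthogonal_val] at h5
    rw [h5, resolventProj, add_sub_cancel_left, Real.sqrt_sq (norm_nonneg _), norm_sub_rev]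

theorem spectralFamily_measure (hR : IsResolvent G R) {x : H} {ν : Measure ℝ}
    (h : IsVectorMeasure R x ν) :
    hR.spectralFamily.measure x = ν.map fun r => r⁻¹ - 1 := by
  have := h.finite
  have := hR.spectralFamily.isFiniteMeasure x
  refine Measure.ext_of_Iic _ _ fun t => ?_
  rw [SpectralFamily.measure_Iic,
    show hR.spectralFamily.proj t = resolventProj R t from rfl, ← hR.norm_resolventProj_sq h,
    ofReal_measureReal]

/-- The measure of `R y` has density `r²` with respect to the measure of `y`. -/
theorem vectorMeasure_apply (hR : IsResolvent G R) {y : H} {ν ν' : Measure ℝ}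
    (h : IsVectorMeasure R y ν) (h' : IsVectorMeasure R (R y) ν') :
    ν' = ν.withDensity fun r => ENNReal.ofReal (r ^ 2) := by
  have := h.finite
  have := h'.finite
  have hm : Measurable fun r : ℝ => ENNReal.ofReal (r ^ 2) := by fun_prop
  have hfin : IsFiniteMeasure (ν.withDensity fun r => ENNReal.ofReal (r ^ 2)) := by
    refine isFiniteMeasure_withDensity (ne_of_lt ?_)
    calc ∫⁻ r, ENNReal.ofReal (r ^ 2) ∂ν ≤ ∫⁻ _, 1 ∂ν := by
          refine lintegral_mono_ae (h.ae_mem.mono fun r hr => ?_)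
          rw [ENNReal.ofReal_le_one]
          exact pow_le_one₀ hr.1 hr.2
      _ < ∞ := by simp
  refine ext_of_forall_integral_eq_of_IsFiniteMeasure fun f => ?_
  rw [integral_withDensity_eq_integral_toReal_smul hm (by simp)]
  have hid : ∀ z, R z = cfc (fun r : ℝ => r) R z := fun z => by
    rw [cfc_id' ℝ R hR.isSelfAdjoint]
  have hf : Continuous fun r => f r := f.continuous
  rw [h'.integral_eq _ hf, hR.inner_left, hid, hid, cfc_apply_cfc_apply R hf continuous_id',
    cfc_apply_cfc_apply R (f := fun r => r) (g := fun r => f r * r) continuous_id' (by fun_prop),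
    ← h.integral_eq _ (by fun_prop)]
  refine integral_congr_ae (Eventually.of_forall fun r => ?_)
  simp only [smul_eq_mul]
  rw [ENNReal.toReal_ofReal (sq_nonneg r)]
  ring

/-- The density r² of the measure of Ry absorbs the singularity: r²(r⁻¹ − 1)² = (1 − r)² ≤ 1. -/
theorem lintegral_sq_lt_top (hR : IsResolvent G R) {y : H} {ν ν' : Measure ℝ}
    (h : IsVectorMeasure R y ν) (h' : IsVectorMeasure R (R y) ν') :
    ∫⁻ r, ENNReal.ofReal ((r⁻¹ - 1) ^ 2) ∂ν' < ∞ := by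
  have := h.finite
  rw [hR.vectorMeasure_apply h h', lintegral_withDensity_eq_lintegral_mul _ (by fun_prop)
    (by fun_prop)]
  calc _ ≤ ∫⁻ _, 1 ∂ν := by
        refine lintegral_mono_ae ((hR.ae_mem_Ioc h).mono fun r hr => ?_)
        simp only [Pi.mul_apply]
        rw [← ENNReal.ofReal_mul (sq_nonneg r), ENNReal.ofReal_le_one, ← mul_pow, mul_sub,
          mul_inv_cancel₀ hr.1.ne']
        exact pow_le_one₀ (by linarith [hr.2]) (by linarith [hr.1])
    _ < ∞ := by simp

theorem integral_eq (hR : IsResolvent G R) {y : H} {ν ν' : Measure ℝ}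
    (h : IsVectorMeasure R y ν) (h' : IsVectorMeasure R (R y) ν') :
    ∫ r, (r⁻¹ - 1) ∂ν' = (⟪R y, y - R y⟫_ℂ).re := by
  rw [hR.vectorMeasure_apply h h', integral_withDensity_eq_integral_toReal_smul (by fun_prop)
    (by simp)]
  have h1 : ∫ r, (ENNReal.ofReal (r ^ 2)).toReal • (r⁻¹ - 1) ∂ν = ∫ r, r * (1 - r) ∂ν := by
    refine integral_congr_ae ((hR.ae_mem_Ioc h).mono fun r hr => ?_)
    simp only [smul_eq_mul]
    rw [ENNReal.toReal_ofReal (sq_nonneg r)]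
    field_simp [hr.1.ne']
  have hR' := hR.isSelfAdjoint
  rw [h1, h.integral_eq _ (by fun_prop), hR.inner_left, cfc_mul _ _ R,
    cfc_sub (fun _ => (1 : ℝ)) (fun r => r) R, cfc_const_one ℝ R, cfc_id' ℝ R]
  rfl

/-- Let gₙ be bounded approximations of 1/r and yₙ = gₙ(R)x. Then ‖yₙ‖ stays bounded and Ryₙ → x,
while ⟨Ryₙ, Gx'⟩ = ⟨yₙ − Ryₙ, x'⟩. In the limit ⟨x, Gx'⟩ is bounded by a multiple of ‖x'‖, so x lies
in the domain of G* = G. -/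
theorem mem_domain_of_lintegral_lt_top (hR : IsResolvent G R) (hG : IsSelfAdjoint G) {x : H}
    {ν : Measure ℝ} (h : IsVectorMeasure R x ν)
    (hfin : ∫⁻ r, ENNReal.ofReal ((r⁻¹ - 1) ^ 2) ∂ν < ∞) : x ∈ G.domain := by
  have := h.finite
  have hRs := hR.isSelfAdjoint
  have hint : Integrable (fun r : ℝ => (r⁻¹ - 1) ^ 2) ν := by
    refine ⟨by fun_prop, ?_⟩
    rw [hasFiniteIntegral_iff_ofReal (Eventually.of_forall fun r => sq_nonneg _)]
    exact hfin
  -- Dominates ∫ r⁻²: the inequality r⁻² ≤ 2(r⁻¹ − 1)² + 2 is (r⁻¹ − 2)² ≥ 0.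
  set M := ∫ r, (2 * (r⁻¹ - 1) ^ 2 + 2) ∂ν
  let g : ℕ → ℝ → ℝ := fun n r => (max |r| (1 / ((n : ℝ) + 1)))⁻¹
  have hg : ∀ n, Continuous (g n) := continuous_inv_max continuous_abs
  have hbound : ∀ n, ‖cfc (g n) R x‖ ≤ √M := by
    intro n
    apply Real.le_sqrt_of_sq_le
    rw [h.norm_cfc_sq (hg n)]
    refine integral_mono_ae (h.integrable ((hg n).pow 2))
      ((hint.const_mul 2).add (integrable_const 2)) ?_
    filter_upwards [hR.ae_mem_Ioc h] with r hr
    have h1 : g n r ≤ r⁻¹ := by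
      apply inv_anti₀ hr.1
      exact (le_abs_self r).trans (le_max_left _ _)
    have h2 : 0 ≤ g n r := by positivity
    have h3 : g n r ^ 2 ≤ r⁻¹ ^ 2 := by gcongr
    exact h3.trans (by nlinarith [sq_nonneg (r⁻¹ - 2)])
  have hlim : Tendsto (fun n => R (cfc (g n) R x)) atTop (𝓝 x) := by
    have h1 := tendsto_cfc_zeroCutoff hRs continuous_abs abs_nonneg x
    rw [hR.starProjection_ker_abs] at h1
    have h2 := (tendsto_const_nhds (x := x)).sub h1
    rw [sub_zero] at h2
    refine h2.congr fun n => ?_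
    have h3 : cfc (zeroCutoff (fun r => |r|) n) R = 1 - cfc (fun r : ℝ => |r|) R * cfc (g n) R := by
      rw [← cfc_mul _ _ R continuous_abs.continuousOn (hg n).continuousOn, ← cfc_const_one ℝ R,
        ← cfc_sub (fun _ => (1 : ℝ)) (fun r => |r| * g n r) R continuous_const.continuousOn
          (continuous_abs.mul (hg n)).continuousOn]
      congr 1
      funext r
      simp only [zeroCutoff, g]
      ring
    rw [h3, hR.cfc_abs_eq, sub_apply, mul_apply_eq_comp]
    simp
  obtain ⟨y, hy⟩ := exists_mem_graph_of_norm_inner_le hG (x := x) (√M + √M) fun x' y' h' => by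
    have h1 : Tendsto (fun n => ‖⟪R (cfc (g n) R x), y'⟫_ℂ‖) atTop (𝓝 ‖⟪x, y'⟫_ℂ‖) :=
      (hlim.inner tendsto_const_nhds).norm
    refine le_of_tendsto h1 (Eventually.of_forall fun n => ?_)
    rw [← inner_eq_of_mem_graph hG (hR.mem_graph (cfc (g n) R x)) h']
    refine (norm_inner_le_norm _ _).trans ?_
    gcongr
    refine (norm_sub_le _ _).trans (add_le_add (hbound n) ?_)
    refine (R.le_of_opNorm_le hR.norm_le _).trans ?_
    rw [one_mul]; exact hbound n
  exact LinearPMap.mem_domain_of_mem_graph hy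

theorem isResolutionOf (hR : IsResolvent G R) (hG : IsSelfAdjoint G) :
    hR.spectralFamily.IsResolutionOf G := by
  have hm : Measurable fun r : ℝ => r⁻¹ - 1 := measurable_inv.sub_const 1
  constructor
  · intro x
    obtain ⟨ν, hν⟩ := hR.exists_isVectorMeasure x
    rw [hR.spectralFamily_measure hν, lintegral_map (by fun_prop) hm]
    constructor
    · intro hx
      have h1 := (hR.mem_graph_iff _ _).mp (G.mem_graph ⟨x, hx⟩)
      obtain ⟨ν', hν'⟩ := hR.exists_isVectorMeasure (x + G ⟨x, hx⟩)
      refine hR.lintegral_sq_lt_top hν' ?_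
      rw [h1]
      exact hν
    · exact hR.mem_domain_of_lintegral_lt_top hG hν
  · intro x
    obtain ⟨ν, hν⟩ := hR.exists_isVectorMeasure (x : H)
    have h1 := (hR.mem_graph_iff _ _).mp (G.mem_graph x)
    obtain ⟨ν', hν'⟩ := hR.exists_isVectorMeasure ((x : H) + G x)
    rw [hR.spectralFamily_measure hν, integral_map hm.aemeasurable (by fun_prop)]
    have h2 := hR.integral_eq hν' (ν' := ν) (by rw [h1]; exact hν)
    rw [h1, add_sub_cancel_left] at h2
    rw [h2]
    have h3 := inner_eq_of_mem_graph hG (G.mem_graph x) (G.mem_graph x)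
    have h4 := inner_conj_symm (𝕜 := ℂ) (x : H) (G x)
    rw [h3] at h4
    exact (Complex.conj_eq_iff_re.mp h4).symm

end IsResolvent

theorem exists_isResolutionOf {G : H →ₗ.[ℂ] H} (hG : IsPositiveSelfAdjoint G) :
    ∃ E : SpectralFamily H, E.IsResolutionOf G := by
  obtain ⟨R, hR⟩ := exists_isResolvent hG
  exact ⟨hR.spectralFamily, hR.isResolutionOf hG.1⟩

end SpectralFamily
-- Cut-offs of G and √G, for an arbitrary spectral resolution of G.
section Cutoff

set_option linter.unusedSectionVars false

open MeasureTheory Filter Topology Set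

variable {H : Type*} [NormedAddCommGroup H] [InnerProductSpace ℂ H] [CompleteSpace H]

theorem snd_eq_of_mem_graph {T : H →ₗ.[ℂ] H} {x y y' : H} (h : (x, y) ∈ T.graph)
    (h' : (x, y') ∈ T.graph) : y = y' :=
  LinearPMap.mem_graph_snd_inj T h h' rfl

namespace SpectralFamily

variable (E : SpectralFamily H)

theorem inner_proj_left (t : ℝ) (x y : H) : ⟪E.proj t x, y⟫_ℂ = ⟪x, E.proj t y⟫_ℂ :=
  ContinuousLinearMap.isSelfAdjoint_iff_isSymmetric.mp (E.isStarProjection t).isSelfAdjoint x y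

theorem proj_proj_of_le {s t : ℝ} (h : s ≤ t) (x : H) :
    E.proj s (E.proj t x) = E.proj s x :=
  congrArg (fun T : H →L[ℂ] H => T x) (E.mul_eq_of_le s t h)

theorem proj_proj_of_ge {s t : ℝ} (h : t ≤ s) (x : H) :
    E.proj s (E.proj t x) = E.proj t x := by
  refine ext_inner_right ℂ fun y => ?_
  rw [inner_proj_left, inner_proj_left, inner_proj_left, proj_proj_of_le E h]

theorem proj_comm (s t : ℝ) (x : H) : E.proj s (E.proj t x) = E.proj t (E.proj s x) := by
  rcases le_total s t with h | h
  · rw [proj_proj_of_le E h, proj_proj_of_ge E h]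
  · rw [proj_proj_of_le E h, proj_proj_of_ge E h]

theorem norm_proj_le (t : ℝ) (x : H) : ‖E.proj t x‖ ≤ ‖x‖ := by
  simpa using (E.proj t).le_of_opNorm_le (E.isStarProjection t).norm_le x

/-- The projections commute, so the parts E_s u and E_s v stay orthogonal at every level s. -/
theorem measure_add {t : ℝ} {u v : H} (hu : E.proj t u = u) (hv : E.proj t v = 0) :
    E.measure (u + v) = E.measure u + E.measure v := by
  have := E.isFiniteMeasure (u + v)
  refine Measure.ext_of_Iic _ _ fun s => ?_
  rw [Measure.add_apply, measure_Iic, measure_Iic, measure_Iic,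
    ← ENNReal.ofReal_add (sq_nonneg _) (sq_nonneg _), map_add, sq, sq, sq,
    norm_add_sq_eq_norm_sq_add_norm_sq_of_inner_eq_zero (𝕜 := ℂ)]
  rw [← hu, proj_comm, inner_proj_left, proj_comm, hv, map_zero, inner_zero_right]

theorem measure_proj (t : ℝ) (x : H) :
    E.measure (E.proj t x) = (E.measure x).restrict (Iic t) := by
  have := E.isFiniteMeasure (E.proj t x)
  refine Measure.ext_of_Iic _ _ fun s => ?_
  rw [Measure.restrict_apply measurableSet_Iic, Iic_inter_Iic, measure_Iic, measure_Iic]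
  rcases le_total s t with h | h
  · rw [proj_proj_of_le E h, min_eq_left h]
  · rw [proj_proj_of_ge E h, min_eq_right h]

theorem measure_sub_proj (t : ℝ) (x : H) :
    E.measure (x - E.proj t x) = (E.measure x).restrict (Ioi t) := by
  have h1 : E.measure x = E.measure (E.proj t x) + E.measure (x - E.proj t x) := by
    rw [← E.measure_add (t := t) (proj_proj_of_le E le_rfl x), add_sub_cancel]
    rw [map_sub, proj_proj_of_le E le_rfl, sub_self]
  have h2 : E.measure x = (E.measure x).restrict (Iic t) + (E.measure x).restrict (Ioi t) := by
    have := Measure.restrict_add_restrict_compl (μ := E.measure x) (measurableSet_Iic (a := t))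
    rw [compl_Iic] at this
    exact this.symm
  rw [h2, measure_proj] at h1
  have := E.isFiniteMeasure x
  exact ((Measure.add_right_inj _ _ _).mp h1).symm

theorem measure_univ (x : H) : E.measure x univ = ENNReal.ofReal (‖x‖ ^ 2) := by
  have h1 := tendsto_measure_Iic_atTop (E.measure x)
  simp_rw [measure_Iic] at h1
  exact tendsto_nhds_unique h1 (ENNReal.tendsto_ofReal ((E.tendsto_atTop x).norm.pow 2))

namespace IsResolutionOf

variable {E} {G : H →ₗ.[ℂ] H}

theorem mem_domain_iff (hE : E.IsResolutionOf G) (x : H) :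
    x ∈ G.domain ↔ ∫⁻ t, ENNReal.ofReal (t ^ 2) ∂(E.measure x) < ∞ := hE.1 x

theorem inner_eq (hE : E.IsResolutionOf G) {x y : H} (h : (x, y) ∈ G.graph) :
    ⟪x, y⟫_ℂ = ((∫ t, t ∂(E.measure x) : ℝ) : ℂ) := by
  rw [LinearPMap.mem_graph_iff] at h
  obtain ⟨u, rfl, rfl⟩ := h
  exact hE.2 u

theorem integrable (hE : E.IsResolutionOf G) {x : H} (h : x ∈ G.domain) :
    Integrable (fun t : ℝ => t) (E.measure x) := by
  have := E.isFiniteMeasure x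
  have h1 : Integrable (fun t : ℝ => t ^ 2) (E.measure x) := by
    refine ⟨by fun_prop, ?_⟩
    rw [hasFiniteIntegral_iff_ofReal (Eventually.of_forall fun r => sq_nonneg _)]
    exact (hE.mem_domain_iff x).mp h
  refine (h1.add (integrable_const (1 : ℝ))).mono' (by fun_prop)
    (Eventually.of_forall fun t => ?_)
  simp only [Pi.add_apply, Real.norm_eq_abs]
  nlinarith [sq_abs t, sq_nonneg (|t| - 1)]

theorem mem_domain_of_ae_le (hE : E.IsResolutionOf G) {x : H} {C : ℝ}
    (h : ∀ᵐ t ∂(E.measure x), |t| ≤ C) : x ∈ G.domain := by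
  have := E.isFiniteMeasure x
  rw [hE.mem_domain_iff]
  calc ∫⁻ t, ENNReal.ofReal (t ^ 2) ∂(E.measure x)
      ≤ ∫⁻ _, ENNReal.ofReal (C ^ 2) ∂(E.measure x) := by
        refine lintegral_mono_ae (h.mono fun t ht => ENNReal.ofReal_le_ofReal ?_)
        rw [← sq_abs t]
        gcongr
    _ < ∞ := by
        rw [lintegral_const]
        exact ENNReal.mul_lt_top ENNReal.ofReal_lt_top (measure_lt_top _ _)

/-- The vector y = E_b x − E_a x has spectral measure on (a, b], hence 0 ≤ ⟨y, Gy⟩ ≤ b‖y‖², and b <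
0 forces y = 0. Then a → −∞. -/
theorem proj_eq_zero (hE : E.IsResolutionOf G) (hG : IsPositiveSelfAdjoint G) {b : ℝ}
    (hb : b < 0) (x : H) : E.proj b x = 0 := by
  have key : ∀ a, a ≤ b → E.proj b x = E.proj a x := by
    intro a hab
    set y := E.proj b (x - E.proj a x) with hy
    have hy' : y = E.proj b x - E.proj a x := by
      rw [hy, map_sub, proj_proj_of_ge E hab]
    have hmeas : E.measure y = (E.measure x).restrict (Iic b ∩ Ioi a) := by
      rw [hy, measure_proj, measure_sub_proj, Measure.restrict_restrict measurableSet_Iic]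
    have hae : ∀ᵐ t ∂(E.measure y), t ∈ Iic b ∩ Ioi a := by
      rw [hmeas]
      exact ae_restrict_mem (measurableSet_Iic.inter measurableSet_Ioi)
    have hdom : y ∈ G.domain := hE.mem_domain_of_ae_le (C := |a|) (hae.mono fun t ht => by
      have h1 : t ≤ b := ht.1
      have h2 : a < t := ht.2
      rw [abs_of_neg (by linarith), abs_of_neg (by linarith)]
      linarith)
    have := E.isFiniteMeasure y
    have h1 := re_inner_nonneg_of_mem_graph hG (G.mem_graph ⟨y, hdom⟩)
    rw [hE.inner_eq (G.mem_graph ⟨y, hdom⟩), Complex.ofReal_re] at h1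
    have h2 : ∫ t, t ∂(E.measure y) ≤ ∫ _, b ∂(E.measure y) :=
      integral_mono_ae (hE.integrable hdom) (integrable_const _) (hae.mono fun t ht => ht.1)
    rw [integral_const, smul_eq_mul, Measure.real, measure_univ,
      ENNReal.toReal_ofReal (sq_nonneg _)] at h2
    have h3 : ‖y‖ ^ 2 = 0 := by
      have h4 := h1.trans h2
      have h5 := sq_nonneg ‖y‖
      nlinarith
    have h4 : y = 0 := by simpa using h3
    rw [hy'] at h4
    exact sub_eq_zero.mp h4
  refine tendsto_nhds_unique (tendsto_const_nhds.congr' ?_) (E.tendsto_atBot x)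
  filter_upwards [eventually_le_atBot b] with a ha using key a ha

theorem ae_nonneg (hE : E.IsResolutionOf G) (hG : IsPositiveSelfAdjoint G) (x : H) :
    ∀ᵐ t ∂(E.measure x), 0 ≤ t := by
  have h : ∀ n : ℕ, E.measure x (Iic (-(1 / ((n : ℝ) + 1)))) = 0 := by
    intro n
    rw [measure_Iic, hE.proj_eq_zero hG (neg_neg_of_pos (by positivity))]
    simp
  rw [ae_iff]
  refine measure_mono_null (fun t ht => ?_) (measure_iUnion_null h)
  obtain ⟨n, hn⟩ := exists_nat_one_div_lt (neg_pos.mpr (not_le.mp ht))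
  exact mem_iUnion.mpr ⟨n, by simp only [mem_Iic]; linarith⟩

theorem proj_mem_domain (hE : E.IsResolutionOf G) (hG : IsPositiveSelfAdjoint G) (t : ℝ) (x : H) :
    E.proj t x ∈ G.domain := by
  refine hE.mem_domain_of_ae_le (C := t) ?_
  have h1 : ∀ᵐ s ∂(E.measure (E.proj t x)), s ∈ Iic t := by
    rw [measure_proj]
    exact ae_restrict_mem measurableSet_Iic
  filter_upwards [h1, hE.ae_nonneg hG (E.proj t x)] with s hs hs0
  rw [abs_of_nonneg hs0]
  exact hs

/-- A resolution prescribes only the quadratic form of G. Additivity of the measures on u + v makes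
the cross term Re⟨u, Gv⟩ vanish; replacing u by iu removes the imaginary part. -/
theorem inner_eq_zero (hE : E.IsResolutionOf G) (hG : IsPositiveSelfAdjoint G) {t : ℝ}
    {u u' v v' : H} (hu : (u, u') ∈ G.graph) (hv : (v, v') ∈ G.graph) (hu1 : E.proj t u = u)
    (hv1 : E.proj t v = 0) : ⟪u, v'⟫_ℂ = 0 := by
  have key : ∀ w w' : H, (w, w') ∈ G.graph → E.proj t w = w → (⟪w, v'⟫_ℂ).re = 0 := by
    intro w w' hw hw1
    have h1 := hE.inner_eq hw
    have h2 := hE.inner_eq hv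
    have h3 := hE.inner_eq (add_mem hw hv : (w + v, w' + v') ∈ G.graph)
    rw [E.measure_add hw1 hv1, integral_add_measure
      (hE.integrable (LinearPMap.mem_domain_of_mem_graph hw))
      (hE.integrable (LinearPMap.mem_domain_of_mem_graph hv)), Complex.ofReal_add, ← h1, ← h2,
      inner_add_left, inner_add_right, inner_add_right] at h3
    simp only at h3
    have h4 := inner_eq_of_mem_graph hG.1 hw hv
    have h5 := inner_conj_symm (𝕜 := ℂ) v w'
    rw [h4] at h5
    have h6 : ⟪w, v'⟫_ℂ + (starRingEnd ℂ) ⟪w, v'⟫_ℂ = 0 := by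
      rw [h5]
      linear_combination h3
    have h7 := congrArg Complex.re h6
    rw [Complex.add_re, Complex.conj_re, Complex.zero_re] at h7
    linarith
  apply Complex.ext
  · exact key u u' hu hu1
  · have h := key (Complex.I • u) (Complex.I • u') (G.graph.smul_mem Complex.I hu)
      (by rw [map_smul, hu1])
    rw [inner_smul_left] at h
    simpa using h

/-- E_t commutes with G because G has no off-diagonal part between the range and the kernel of E_t:
for z = G E_t x this gives both E_t(y − z) = 0 and E_t z = z. -/
theorem proj_mem_graph (hE : E.IsResolutionOf G) (hG : IsPositiveSelfAdjoint G) (t : ℝ)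
    {x y : H} (h : (x, y) ∈ G.graph) : (E.proj t x, E.proj t y) ∈ G.graph := by
  obtain ⟨z, hz⟩ : ∃ z, (E.proj t x, z) ∈ G.graph :=
    ⟨_, G.mem_graph ⟨_, hE.proj_mem_domain hG t x⟩⟩
  have hidem : ∀ w, E.proj t (E.proj t w) = E.proj t w := proj_proj_of_le E le_rfl
  have h1 : E.proj t (y - z) = 0 := by
    refine ext_inner_left ℂ fun w => ?_
    rw [inner_zero_right, ← inner_proj_left]
    exact hE.inner_eq_zero hG (G.mem_graph ⟨_, hE.proj_mem_domain hG t w⟩)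
      (sub_mem h hz : (x - E.proj t x, y - z) ∈ G.graph) (hidem w)
      (by rw [map_sub, hidem, sub_self])
  have h2 : z = E.proj t z := by
    refine hG.1.dense_domain.eq_of_inner_left ℂ fun v hv => ?_
    have hv' := G.mem_graph ⟨v, hv⟩
    have hv'' := G.mem_graph ⟨_, hE.proj_mem_domain hG t v⟩
    have h3 := sub_mem hv' hv''
    have h4 := hE.inner_eq_zero hG hz h3 (hidem x)
      (by simp only; rw [map_sub, hidem, sub_self])
    have h5 := inner_eq_of_mem_graph hG.1 hz h3
    rw [h4] at h5
    simp only [inner_sub_right] at h5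
    rw [inner_proj_left]
    exact sub_eq_zero.mp h5
  rw [map_sub, ← h2, sub_eq_zero] at h1
  rw [h1]
  exact hz

/-- The operator `G E_t`. -/
theorem exists_mul_proj (hE : E.IsResolutionOf G) (hG : IsPositiveSelfAdjoint G) (t : ℝ) :
    ∃ B : H →L[ℂ] H, ∀ x, (E.proj t x, B x) ∈ G.graph := by
  let L : H →ₗ[ℂ] H := G.toFun.comp
    ((E.proj t).toLinearMap.codRestrict G.domain (hE.proj_mem_domain hG t))
  have hL : ∀ x, (E.proj t x, L x) ∈ G.graph := fun x =>
    G.mem_graph ⟨_, hE.proj_mem_domain hG t x⟩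
  have hproj : ∀ x, E.proj t (L x) = L x := fun x => by
    have h := hE.proj_mem_graph hG t (hL x)
    rw [proj_proj_of_le E le_rfl] at h
    exact snd_eq_of_mem_graph h (hL x)
  have hsymm : L.IsSymmetric := fun x y => by
    rw [← hproj x, inner_proj_left, inner_eq_of_mem_graph hG.1 (hL x) (hL y), inner_proj_left,
      hproj]
  -- Hellinger–Toeplitz: a symmetric operator defined everywhere is bounded.
  exact ⟨⟨L, hsymm.continuous⟩, hL⟩

end IsResolutionOf
end SpectralFamily

theorem sqrtOp_isPositiveSqrt {G : H →ₗ.[ℂ] H} (hG : IsPositiveSelfAdjoint G) :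
    IsPositiveSqrt (sqrtOp G) G := by
  have h := exists_isPositiveSqrt hG
  rw [sqrtOp, dif_pos h]
  exact h.choose_spec

/-- Spectral cut-offs: `P n` is the spectral projector of `G` for `[0, n]`, and `K n = √G P n`. -/
structure IsCutoff (G : H →ₗ.[ℂ] H) (P K : ℕ → H →L[ℂ] H) : Prop where
  inner_left : ∀ n x y, ⟪P n x, y⟫_ℂ = ⟪x, P n y⟫_ℂ
  norm_le : ∀ n x, ‖P n x‖ ≤ ‖x‖
  apply_apply : ∀ {m n} (x : H), m ≤ n → P m (P n x) = P m x
  tendsto : ∀ x, Tendsto (fun n => P n x) atTop (𝓝 x)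
  mem_graph_sqrt : ∀ n x, (P n x, K n x) ∈ (sqrtOp G).graph
  mem_graph_sqrt' : ∀ n x, (K n x, truncation G n x) ∈ (sqrtOp G).graph
  apply_truncation : ∀ n x, P n (truncation G n x) = truncation G n x

theorem exists_isCutoff {G : H →ₗ.[ℂ] H} (hG : IsPositiveSelfAdjoint G) :
    ∃ P K : ℕ → H →L[ℂ] H, IsCutoff G P K := by
  have hex := exists_isResolutionOf hG
  obtain ⟨hSs, hS⟩ := sqrtOp_isPositiveSqrt hG
  set E := hex.choose with hEdef
  have hE : E.IsResolutionOf G := hex.choose_spec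
  have hproj : ∀ t, spectralProjector G t = E.proj t := fun t => by
    rw [spectralProjector, dif_pos hex]
  have htrunc : ∀ (t : ℝ) (x : H), (E.proj t x, truncation G t x) ∈ G.graph := by
    intro t
    obtain ⟨B, hB⟩ := hE.exists_mul_proj hG t
    -- G E_t extends E_t G from the dense domain of G, so it is the extension selected by
    -- `truncation`.
    have hB' : ∀ x : G.domain, B (x : H) = spectralProjector G t (G x) := fun x => by
      rw [hproj]
      exact snd_eq_of_mem_graph (hB x) (hE.proj_mem_graph hG t (G.mem_graph x))
    have h : ∃ B : H →L[ℂ] H, ∀ x : G.domain, B (x : H) = spectralProjector G t (G x) := ⟨B, hB'⟩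
    have h1 : truncation G t = B := by
      rw [truncation, dif_pos h]
      refine ContinuousLinearMap.ext_on (s := (G.domain : Set H)) ?_ fun x hx => ?_
      · simpa using hG.1.dense_domain
      · rw [h.choose_spec ⟨x, hx⟩, hB' ⟨x, hx⟩]
    rw [h1]
    exact hB
  have hfix : ∀ (t : ℝ) (x : H), E.proj t (truncation G t x) = truncation G t x := fun t x => by
    have h := hE.proj_mem_graph hG t (htrunc t x)
    rw [E.proj_proj_of_le le_rfl] at h
    exact snd_eq_of_mem_graph h (htrunc t x)
  have hK : ∀ n : ℕ, ∃ K : H →L[ℂ] H, ∀ x, (E.proj n x, K x) ∈ (sqrtOp G).graph ∧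
      (K x, truncation G n x) ∈ (sqrtOp G).graph := by
    intro n
    have hdom : ∀ x, E.proj n x ∈ (sqrtOp G).domain := fun x => by
      obtain ⟨z, hz, -⟩ := (hS _ _).mp (htrunc n x)
      exact LinearPMap.mem_domain_of_mem_graph hz
    let L : H →ₗ[ℂ] H := (sqrtOp G).toFun.comp
      ((E.proj n).toLinearMap.codRestrict (sqrtOp G).domain hdom)
    have hL : ∀ x, (E.proj n x, L x) ∈ (sqrtOp G).graph := fun x =>
      (sqrtOp G).mem_graph ⟨_, hdom x⟩
    have hL' : ∀ x, (L x, truncation G n x) ∈ (sqrtOp G).graph := fun x => by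
      obtain ⟨z, hz, hz'⟩ := (hS _ _).mp (htrunc n x)
      rwa [snd_eq_of_mem_graph (hL x) hz]
    have hbound : ∀ x, ‖L x‖ ≤ √‖truncation G n‖ * ‖x‖ := fun x => by
      have h1 := inner_eq_of_mem_graph hSs.1 (hL x) (hL' x)
      have h2 : ‖L x‖ ^ 2 ≤ ‖truncation G n‖ * ‖x‖ ^ 2 := by
        rw [← re_inner_self, h1]
        refine (Complex.re_le_norm _).trans ((norm_inner_le_norm _ _).trans ?_)
        have h3 := E.norm_proj_le n x
        have h4 := (truncation G n).le_opNorm x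
        calc _ ≤ ‖x‖ * (‖truncation G n‖ * ‖x‖) := by gcongr
          _ = _ := by ring
      refine le_of_sq_le_sq ?_ (by positivity)
      rw [mul_pow, Real.sq_sqrt (norm_nonneg _)]
      exact h2
    exact ⟨L.mkContinuous _ hbound, fun x => ⟨hL x, hL' x⟩⟩
  choose K hK using hK
  exact ⟨fun n => E.proj n, K,
    { inner_left := fun n => E.inner_proj_left n
      norm_le := fun n => E.norm_proj_le n
      apply_apply := fun x h => E.proj_proj_of_le (Nat.cast_le.mpr h) x
      tendsto := fun x => (E.tendsto_atTop x).comp tendsto_natCast_atTop_atTop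
      mem_graph_sqrt := fun n x => (hK n x).1
      mem_graph_sqrt' := fun n x => (hK n x).2
      apply_truncation := fun n => hfix n }⟩

namespace IsCutoff

variable {G : H →ₗ.[ℂ] H} {P K : ℕ → H →L[ℂ] H}

theorem re_inner_truncation (hK : IsCutoff G P K) (hG : IsPositiveSelfAdjoint G) (n : ℕ) (x : H) :
    (⟪x, truncation G n x⟫_ℂ).re = ‖K n x‖ ^ 2 := by
  have h := inner_eq_of_mem_graph (sqrtOp_isPositiveSqrt hG).1.1 (hK.mem_graph_sqrt n x)
    (hK.mem_graph_sqrt' n x)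
  rw [hK.inner_left, hK.apply_truncation] at h
  rw [← h, re_inner_self]

/-- Makes w − Kₙx orthogonal, in real part, to Kₙx. This replaces a proof that √G commutes with Pₙ,
and yields both the norm bound and the convergence below. -/
theorem re_inner_of_mem_graph (hK : IsCutoff G P K) (hG : IsPositiveSelfAdjoint G) (n : ℕ)
    {x w : H} (h : (x, w) ∈ (sqrtOp G).graph) : (⟪w, K n x⟫_ℂ).re = ‖K n x‖ ^ 2 := by
  rw [inner_eq_of_mem_graph (sqrtOp_isPositiveSqrt hG).1.1 h (hK.mem_graph_sqrt' n x),
    hK.re_inner_truncation hG]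

theorem norm_le_of_mem_graph (hK : IsCutoff G P K) (hG : IsPositiveSelfAdjoint G) (n : ℕ)
    {x w : H} (h : (x, w) ∈ (sqrtOp G).graph) : ‖K n x‖ ≤ ‖w‖ := by
  have h1 := hK.re_inner_of_mem_graph hG n h
  have h2 := (Complex.re_le_norm _).trans (norm_inner_le_norm (𝕜 := ℂ) w (K n x))
  rw [h1] at h2
  by_contra! h3
  nlinarith [norm_nonneg w]

theorem norm_mono (hK : IsCutoff G P K) (hG : IsPositiveSelfAdjoint G) (x : H) :
    Monotone fun n => ‖K n x‖ := by
  intro m n hmn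
  have h1 := hK.mem_graph_sqrt m (P n x)
  rw [hK.apply_apply x hmn] at h1
  have h2 := snd_eq_of_mem_graph h1 (hK.mem_graph_sqrt m x)
  simp only
  rw [← h2]
  exact hK.norm_le_of_mem_graph hG m (hK.mem_graph_sqrt n x)

/-- The norms ‖Kₙx‖ increase to some L ≤ ‖w‖. Testing against the dense domain of √G gives |⟨w, z⟩|
≤ L‖z‖, so L = ‖w‖, and ‖w − Kₙx‖² = ‖w‖² − ‖Kₙx‖² then tends to 0. -/
theorem tendsto_of_mem_graph (hK : IsCutoff G P K) (hG : IsPositiveSelfAdjoint G)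
    {x w : H} (h : (x, w) ∈ (sqrtOp G).graph) : Tendsto (fun n => K n x) atTop (𝓝 w) := by
  have hS := (sqrtOp_isPositiveSqrt hG).1.1
  have hbdd : BddAbove (range fun n => ‖K n x‖) :=
    ⟨‖w‖, by rintro _ ⟨n, rfl⟩; exact hK.norm_le_of_mem_graph hG n h⟩
  have hlim := tendsto_atTop_ciSup (hK.norm_mono hG x) hbdd
  set L := ⨆ n, ‖K n x‖
  have hL : ∀ z : H, ‖⟪w, z⟫_ℂ‖ ≤ L * ‖z‖ := by
    have hcl : IsClosed {z : H | ‖⟪w, z⟫_ℂ‖ ≤ L * ‖z‖} :=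
      isClosed_le (by fun_prop) (by fun_prop)
    have hsub : ((sqrtOp G).domain : Set H) ⊆ {z : H | ‖⟪w, z⟫_ℂ‖ ≤ L * ‖z‖} := by
      intro z hz
      have hz' := (sqrtOp G).mem_graph ⟨z, hz⟩
      have h1 : Tendsto (fun n => ‖⟪K n x, z⟫_ℂ‖) atTop (𝓝 ‖⟪w, z⟫_ℂ‖) := by
        have h2 := inner_eq_of_mem_graph hS h hz'
        simp only at h2
        rw [h2]
        refine (((hK.tendsto x).inner tendsto_const_nhds).norm).congr fun n => ?_
        rw [inner_eq_of_mem_graph hS (hK.mem_graph_sqrt n x) hz']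
      refine le_of_tendsto h1 (Eventually.of_forall fun n => ?_)
      refine (norm_inner_le_norm _ _).trans ?_
      gcongr
      exact le_ciSup hbdd n
    intro z
    have := hcl.closure_subset_iff.mpr hsub
    rw [hS.dense_domain.closure_eq] at this
    exact this (mem_univ z)
  have hw : ‖w‖ ≤ L := by
    rcases (norm_nonneg w).eq_or_lt with h0 | h0
    · rw [← h0]; exact (norm_nonneg _).trans (le_ciSup hbdd 0)
    · have h1 := (Complex.re_le_norm _).trans (hL w)
      rw [re_inner_self, sq] at h1
      exact le_of_mul_le_mul_right h1 h0
  have hLw : L = ‖w‖ := le_antisymm (ciSup_le fun n => hK.norm_le_of_mem_graph hG n h) hw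
  rw [tendsto_iff_norm_sub_tendsto_zero]
  have h4 : Tendsto (fun n => √(‖w‖ ^ 2 - ‖K n x‖ ^ 2)) atTop (𝓝 0) := by
    have := ((hlim.pow 2).const_sub (‖w‖ ^ 2)).sqrt
    rw [hLw] at this
    simpa using this
  refine h4.congr fun n => ?_
  have h5 : ‖w - K n x‖ ^ 2 = ‖w‖ ^ 2 - 2 * (⟪w, K n x⟫_ℂ).re + ‖K n x‖ ^ 2 :=
    norm_sub_sq (𝕜 := ℂ) w (K n x)
  rw [hK.re_inner_of_mem_graph hG n h] at h5
  rw [norm_sub_rev, ← Real.sqrt_sq (norm_nonneg (w - K n x)), h5]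
  congr 1
  ring

theorem exists_mem_graph (hK : IsCutoff G P K) (hG : IsPositiveSelfAdjoint G) {x : H} {C : ℝ}
    (hC : ∀ n, ‖K n x‖ ≤ C) : ∃ w, (x, w) ∈ (sqrtOp G).graph := by
  have hS := (sqrtOp_isPositiveSqrt hG).1.1
  refine exists_mem_graph_of_norm_inner_le hS C fun z z' hz => ?_
  have h1 : Tendsto (fun n => ‖⟪P n x, z'⟫_ℂ‖) atTop (𝓝 ‖⟪x, z'⟫_ℂ‖) :=
    ((hK.tendsto x).inner tendsto_const_nhds).norm
  refine le_of_tendsto h1 (Eventually.of_forall fun n => ?_)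
  rw [← inner_eq_of_mem_graph hS (hK.mem_graph_sqrt n x) hz]
  refine (norm_inner_le_norm _ _).trans ?_
  gcongr
  exact hC n

end IsCutoff

end Cutoff
-- Rank-one decompositions, traces, and the energy of a positive operator.
section Trace

set_option linter.unusedSectionVars false

open MeasureTheory Filter Topology Set

variable {H : Type*} [NormedAddCommGroup H] [InnerProductSpace ℂ H] [CompleteSpace H]

theorem hasSum_norm_inner_sq {ι : Type*} (b : HilbertBasis ι ℂ H) (x : H) :
    HasSum (fun j => ‖⟪b j, x⟫_ℂ‖ ^ 2) (‖x‖ ^ 2) := by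
  have h := Complex.hasSum_re (b.hasSum_inner_mul_inner x x)
  rw [re_inner_self] at h
  refine h.congr_fun fun j => ?_
  rw [← inner_conj_symm x (b j), ← Complex.normSq_eq_conj_mul_self, Complex.ofReal_re,
    Complex.normSq_eq_norm_sq]

theorem norm_inner_comm_sq (x y : H) : ‖⟪x, y⟫_ℂ‖ ^ 2 = ‖⟪y, x⟫_ℂ‖ ^ 2 := by
  rw [norm_inner_symm]

theorem IsDecomposition.hasSum_inner {φ : ℕ → H} {ρ : H →L[ℂ] H} (h : IsDecomposition φ ρ)
    (x y : H) : HasSum (fun i => ⟪φ i, y⟫_ℂ * ⟪x, φ i⟫_ℂ) ⟪x, ρ y⟫_ℂ := by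
  have h1 := h.mapL ((innerSL ℂ x).comp (ContinuousLinearMap.apply ℂ H y))
  simpa [inner_smul_right] using h1

theorem IsDecomposition.hasSum_norm_inner_sq {φ : ℕ → H} {ρ : H →L[ℂ] H}
    (h : IsDecomposition φ ρ) (y : H) :
    HasSum (fun i => ‖⟪φ i, y⟫_ℂ‖ ^ 2) (⟪y, ρ y⟫_ℂ).re := by
  refine (Complex.hasSum_re (h.hasSum_inner y y)).congr_fun fun i => ?_
  rw [← inner_conj_symm y (φ i), Complex.mul_conj, Complex.ofReal_re,
    Complex.normSq_eq_norm_sq]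

theorem IsDecomposition.isPositive {φ : ℕ → H} {ρ : H →L[ℂ] H} (h : IsDecomposition φ ρ) :
    ρ.IsPositive := by
  rw [ContinuousLinearMap.isPositive_iff_complex]
  intro x
  have h1 : ⟪x, ρ x⟫_ℂ = ((⟪x, ρ x⟫_ℂ).re : ℂ) := by
    refine (h.hasSum_inner x x).unique ?_
    refine (Complex.hasSum_ofReal.mpr (h.hasSum_norm_inner_sq x)).congr_fun fun i => ?_
    rw [← inner_conj_symm x (φ i), Complex.mul_conj, Complex.normSq_eq_norm_sq]
  have h2 : ⟪ρ x, x⟫_ℂ = ⟪x, ρ x⟫_ℂ := by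
    rw [← inner_conj_symm, h1, Complex.conj_ofReal]
  rw [h2]
  exact ⟨h1.symm, (h.hasSum_norm_inner_sq x).nonneg fun i => sq_nonneg _⟩

theorem isTraceClass_iff {ρ : H →L[ℂ] H} (hρ : ρ.IsPositive) :
    IsTraceClass ρ ↔ Summable fun j => (⟪basis H j, ρ (basis H j)⟫_ℂ).re := by
  rw [IsTraceClass, CFC.abs_of_nonneg ρ ((ContinuousLinearMap.nonneg_iff_isPositive ρ).mpr hρ)]

theorem isDecomposition_of_summable {φ : ℕ → H} (h : Summable fun i => ‖φ i‖ ^ 2) :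
    ∃ ρ, IsDecomposition φ ρ := by
  have h1 : Summable fun i => InnerProductSpace.rankOne ℂ (φ i) (φ i) := by
    refine Summable.of_norm ?_
    simpa [sq] using h
  exact h1

/-- Parseval and Tonelli for the double family |⟨φᵢ, eⱼ⟩|². -/
theorem IsDecomposition.tsum_ofReal {φ : ℕ → H} {ρ : H →L[ℂ] H} (h : IsDecomposition φ ρ) :
    ∑' i, ENNReal.ofReal (‖φ i‖ ^ 2)
      = ∑' j, ENNReal.ofReal (⟪basis H j, ρ (basis H j)⟫_ℂ).re := by
  have h1 : ∀ i, ENNReal.ofReal (‖φ i‖ ^ 2)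
      = ∑' j, ENNReal.ofReal (‖⟪φ i, basis H j⟫_ℂ‖ ^ 2) := fun i => by
    rw [← (EnergyNorm.hasSum_norm_inner_sq (basis H) (φ i)).tsum_eq,
      ENNReal.ofReal_tsum_of_nonneg (fun j => sq_nonneg _)
        (EnergyNorm.hasSum_norm_inner_sq (basis H) (φ i)).summable]
    simp_rw [norm_inner_comm_sq (φ i)]
  have h2 : ∀ j, ENNReal.ofReal (⟪basis H j, ρ (basis H j)⟫_ℂ).re
      = ∑' i, ENNReal.ofReal (‖⟪φ i, basis H j⟫_ℂ‖ ^ 2) := fun j => by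
    rw [← (h.hasSum_norm_inner_sq (basis H j)).tsum_eq,
      ENNReal.ofReal_tsum_of_nonneg (fun j => sq_nonneg _)
        (h.hasSum_norm_inner_sq (basis H j)).summable]
  simp_rw [h1, h2]
  exact ENNReal.tsum_comm

theorem summable_iff_tsum_ofReal_ne_top {ι : Type*} {f : ι → ℝ} (hf : ∀ i, 0 ≤ f i) :
    Summable f ↔ ∑' i, ENNReal.ofReal (f i) ≠ ∞ :=
  ⟨fun h => h.tsum_ofReal_ne_top, fun h => by
    have := ENNReal.summable_toReal h
    simpa [ENNReal.toReal_ofReal (hf _)] using this⟩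

theorem IsDecomposition.isTraceClass_iff {φ : ℕ → H} {ρ : H →L[ℂ] H} (h : IsDecomposition φ ρ) :
    IsTraceClass ρ ↔ Summable fun i => ‖φ i‖ ^ 2 := by
  rw [EnergyNorm.isTraceClass_iff h.isPositive,
    summable_iff_tsum_ofReal_ne_top (f := fun j => (⟪basis H j, ρ (basis H j)⟫_ℂ).re)
      fun j => h.isPositive.re_inner_nonneg_right _,
    summable_iff_tsum_ofReal_ne_top fun i => sq_nonneg _, h.tsum_ofReal]

/-- `Tr Bρ = ∑ᵢ ⟨φᵢ|B|φᵢ⟩` for a decomposition `ρ = ∑ᵢ |φᵢ⟩⟨φᵢ|`. -/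
theorem IsDecomposition.trace_mul {φ : ℕ → H} {ρ : H →L[ℂ] H} (h : IsDecomposition φ ρ)
    (hs : Summable fun i => ‖φ i‖ ^ 2) (B : H →L[ℂ] H) :
    HasSum (fun i => ⟪φ i, B (φ i)⟫_ℂ) (trace (B * ρ)) := by
  have h1 : ∀ j, HasSum (fun i => ⟪φ i, basis H j⟫_ℂ * ⟪basis H j, B (φ i)⟫_ℂ)
      ⟪basis H j, (B * ρ) (basis H j)⟫_ℂ := fun j => by
    have := h.hasSum_inner (B.adjoint (basis H j)) (basis H j)
    simp only [ContinuousLinearMap.adjoint_inner_left] at this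
    exact this
  have h2 : ∀ i, HasSum (fun j => ⟪φ i, basis H j⟫_ℂ * ⟪basis H j, B (φ i)⟫_ℂ)
      ⟪φ i, B (φ i)⟫_ℂ := fun i => (basis H).hasSum_inner_mul_inner _ _
  have hsq : ∀ ψ : ℕ → H, (Summable fun i => ‖ψ i‖ ^ 2) →
      Summable fun p : ℕ × basisSet H => ‖⟪basis H p.2, ψ p.1⟫_ℂ‖ ^ 2 := by
    intro ψ hψ
    refine (summable_prod_of_nonneg fun p => sq_nonneg _).mpr
      ⟨fun i => (EnergyNorm.hasSum_norm_inner_sq (basis H) (ψ i)).summable, ?_⟩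
    exact hψ.congr fun i => (EnergyNorm.hasSum_norm_inner_sq (basis H) (ψ i)).tsum_eq.symm
  have hB : Summable fun i => ‖B (φ i)‖ ^ 2 := by
    refine (hs.mul_left (‖B‖ ^ 2)).of_nonneg_of_le (fun i => sq_nonneg _) fun i => ?_
    rw [← mul_pow]
    gcongr
    exact B.le_opNorm _
  -- Fubini needs absolute summability: each product is dominated by the sum of the squares of its
  -- factors, and both square families are summable.
  have hsum : Summable (Function.uncurry fun (i : ℕ) (j : basisSet H) =>
      ⟪φ i, basis H j⟫_ℂ * ⟪basis H j, B (φ i)⟫_ℂ) := by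
    refine Summable.of_norm_bounded ((hsq φ hs).add (hsq _ hB)) fun p => ?_
    simp only [Function.uncurry, norm_mul]
    rw [norm_inner_symm]
    nlinarith [sq_nonneg (‖⟪basis H p.2, φ p.1⟫_ℂ‖ - ‖⟪basis H p.2, B (φ p.1)⟫_ℂ‖),
      sq_nonneg (‖⟪basis H p.2, φ p.1⟫_ℂ‖ + ‖⟪basis H p.2, B (φ p.1)⟫_ℂ‖)]
  have h3 := hsum.tsum_comm
  simp_rw [(h1 _).tsum_eq, (h2 _).tsum_eq] at h3
  rw [trace, h3]
  refine Summable.hasSum (hsum.prod.congr fun i => ?_)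
  exact (h2 i).tsum_eq

theorem IsDecomposition.hasSum_trace {φ : ℕ → H} {ρ : H →L[ℂ] H} (h : IsDecomposition φ ρ)
    (hs : Summable fun i => ‖φ i‖ ^ 2) : HasSum (fun i => ((‖φ i‖ ^ 2 : ℝ) : ℂ)) (trace ρ) := by
  have h1 := h.trace_mul hs 1
  rw [one_mul] at h1
  refine h1.congr_fun fun i => ?_
  rw [one_apply_eq_self, inner_self_eq_norm_sq_to_K]
  push_cast
  rfl

/-- With C = √ρ one has ρ = ∑ⱼ |Ceⱼ⟩⟨Ceⱼ|. Finite trace leaves only countably many nonzero terms;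
these are indexed by ℕ and padded with zeros. -/
theorem exists_isDecomposition {ρ : H →L[ℂ] H} (hρ : ρ ∈ PosTraceClass H) :
    ∃ φ : ℕ → H, IsDecomposition φ ρ := by
  obtain ⟨hpos, htr⟩ := hρ
  have hnn := (ContinuousLinearMap.nonneg_iff_isPositive ρ).mpr hpos
  rw [isTraceClass_iff hpos] at htr
  set C := CFC.sqrt ρ
  have hCC : ∀ x, C (C x) = ρ x := fun x =>
    congrArg (fun T : H →L[ℂ] H => T x) (CFC.sqrt_mul_sqrt_self ρ hnn)
  have hCs : ∀ x y, ⟪C x, y⟫_ℂ = ⟪x, C y⟫_ℂ :=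
    ((ContinuousLinearMap.nonneg_iff_isPositive C).mp (CFC.sqrt_nonneg ρ)).isSymmetric
  have hnorm : ∀ j, (⟪basis H j, ρ (basis H j)⟫_ℂ).re = ‖C (basis H j)‖ ^ 2 := fun j => by
    rw [← hCC, ← hCs, re_inner_self]
  simp_rw [hnorm] at htr
  have hsum : Summable fun j => InnerProductSpace.rankOne ℂ (C (basis H j)) (C (basis H j)) := by
    refine Summable.of_norm ?_
    simpa [sq] using htr
  have hρ : HasSum (fun j => InnerProductSpace.rankOne ℂ (C (basis H j)) (C (basis H j))) ρ := by
    obtain ⟨τ, hτ⟩ := hsum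
    have : τ = ρ := by
      ext x
      have h1 := hτ.mapL (ContinuousLinearMap.apply ℂ H x)
      have h2 := ((basis H).hasSum_repr (C x)).mapL C
      rw [hCC] at h2
      refine h1.unique (h2.congr_fun fun j => ?_)
      simp [HilbertBasis.repr_apply_apply, hCs]
    rwa [this] at hτ
  have hcount : (Function.support fun j => ‖C (basis H j)‖ ^ 2).Countable := htr.countable_support
  set s := Function.support fun j => ‖C (basis H j)‖ ^ 2 with hs
  have : Countable s := hcount.to_subtype
  have := Encodable.ofCountable s
  have hinj : Function.Injective (Encodable.encode : s → ℕ) := Encodable.encode_injective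
  refine ⟨Function.extend Encodable.encode (fun j : s => C (basis H j)) 0, ?_⟩
  rw [IsDecomposition, ← hinj.hasSum_iff]
  · have h1 := (Subtype.val_injective (p := (· ∈ s))).hasSum_iff
      (f := fun j => InnerProductSpace.rankOne ℂ (C (basis H j)) (C (basis H j))) (a := ρ) ?_
    · refine (h1.mpr hρ).congr_fun fun j => ?_
      simp only [Function.comp_apply, hinj.extend_apply]
    · intro j hj
      have hj' : j ∉ s := by simpa using hj
      have : ‖C (basis H j)‖ ^ 2 = 0 := Function.notMem_support.mp hj'
      have : C (basis H j) = 0 := by simpa using this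
      simp [this]
  · intro n hn
    rw [Function.extend_apply' _ _ _ fun ⟨j, hj⟩ => hn ⟨j, hj⟩]
    simp

theorem iSup_tsum_of_monotone {f : ℕ → ℕ → ℝ≥0∞} (hf : ∀ i, Monotone fun n => f n i) :
    ⨆ n, ∑' i, f n i = ∑' i, ⨆ n, f n i := by
  simp_rw [← lintegral_count]
  exact (lintegral_iSup (fun n => measurable_of_countable _) fun m n hmn i => hf i hmn).symm

/-- The truncated traces are ∑ᵢ ‖Kₙφᵢ‖², increasing in n term by term, so monotone convergence moves
the supremum inside. -/
theorem IsDecomposition.energy_eq {G : H →ₗ.[ℂ] H} {P K : ℕ → H →L[ℂ] H} (hK : IsCutoff G P K)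
    (hG : IsPositiveSelfAdjoint G) {φ : ℕ → H} {ρ : H →L[ℂ] H} (h : IsDecomposition φ ρ)
    (hs : Summable fun i => ‖φ i‖ ^ 2) :
    energy G ρ = ∑' i, ⨆ n, ENNReal.ofReal (‖K n (φ i)‖ ^ 2) := by
  rw [energy, ← iSup_tsum_of_monotone]
  · congr 1
    funext n
    have h1 := Complex.hasSum_re (h.trace_mul hs (truncation G n))
    simp_rw [hK.re_inner_truncation hG] at h1
    rw [← h1.tsum_eq, ENNReal.ofReal_tsum_of_nonneg (fun _ => sq_nonneg _) h1.summable]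
  · intro i m n hmn
    have := hK.norm_mono hG (φ i) hmn
    simp only at this ⊢
    gcongr

namespace IsCutoff

variable {G : H →ₗ.[ℂ] H} {P K : ℕ → H →L[ℂ] H}

theorem iSup_eq (hK : IsCutoff G P K) (hG : IsPositiveSelfAdjoint G) {x w : H}
    (h : (x, w) ∈ (sqrtOp G).graph) :
    ⨆ n, ENNReal.ofReal (‖K n x‖ ^ 2) = ENNReal.ofReal (‖w‖ ^ 2) := by
  refine iSup_eq_of_tendsto (fun m n hmn => ?_)
    (ENNReal.tendsto_ofReal ((hK.tendsto_of_mem_graph hG h).norm.pow 2))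
  have := hK.norm_mono hG x hmn
  simp only at this ⊢
  gcongr

theorem exists_mem_graph_of_iSup_ne_top (hK : IsCutoff G P K) (hG : IsPositiveSelfAdjoint G)
    {x : H} (h : ⨆ n, ENNReal.ofReal (‖K n x‖ ^ 2) ≠ ∞) : ∃ w, (x, w) ∈ (sqrtOp G).graph := by
  refine hK.exists_mem_graph hG (C := √(⨆ n, ENNReal.ofReal (‖K n x‖ ^ 2)).toReal) fun n => ?_
  apply Real.le_sqrt_of_sq_le
  rw [← ENNReal.ofReal_le_iff_le_toReal h]
  exact le_iSup (fun n => ENNReal.ofReal (‖K n x‖ ^ 2)) n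

end IsCutoff

/-- A decomposition of an operator of finite energy consists of vectors in the domain of `√G`, and
`Tr Gρ = ∑ᵢ ‖√G φᵢ‖²`. -/
theorem IsDecomposition.exists_sqrt {G : H →ₗ.[ℂ] H} (hG : IsPositiveSelfAdjoint G) {φ : ℕ → H}
    {ρ : H →L[ℂ] H} (h : IsDecomposition φ ρ) (hs : Summable fun i => ‖φ i‖ ^ 2)
    (he : energy G ρ < ∞) : ∃ w : ℕ → H, (∀ i, (φ i, w i) ∈ (sqrtOp G).graph) ∧
      (Summable fun i => ‖w i‖ ^ 2) ∧ energy G ρ = ENNReal.ofReal (∑' i, ‖w i‖ ^ 2) := by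
  obtain ⟨P, K, hK⟩ := exists_isCutoff hG
  have h1 := h.energy_eq hK hG hs
  rw [h1] at he ⊢
  choose w hw using fun i => hK.exists_mem_graph_of_iSup_ne_top hG
    (ENNReal.ne_top_of_tsum_ne_top he.ne i)
  simp_rw [hK.iSup_eq hG (hw _)] at he ⊢
  have hsum : Summable fun i => ‖w i‖ ^ 2 :=
    (summable_iff_tsum_ofReal_ne_top fun i => sq_nonneg _).mpr he.ne
  exact ⟨w, hw, hsum, (ENNReal.ofReal_tsum_of_nonneg (fun _ => sq_nonneg _) hsum).symm⟩

theorem IsDecomposition.energy_of_sqrt {G : H →ₗ.[ℂ] H} (hG : IsPositiveSelfAdjoint G)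
    {φ w : ℕ → H} {ρ : H →L[ℂ] H} (h : IsDecomposition φ ρ) (hs : Summable fun i => ‖φ i‖ ^ 2)
    (hw : ∀ i, (φ i, w i) ∈ (sqrtOp G).graph) :
    energy G ρ = ∑' i, ENNReal.ofReal (‖w i‖ ^ 2) := by
  obtain ⟨P, K, hK⟩ := exists_isCutoff hG
  rw [h.energy_eq hK hG hs]
  simp_rw [hK.iSup_eq hG (hw _)]

end Trace
-- The operator AρA* and its independence of the decomposition.
section Sandwich

set_option linter.unusedSectionVars false

open MeasureTheory Filter Topology Set

variable {H : Type*} [NormedAddCommGroup H] [InnerProductSpace ℂ H] [CompleteSpace H]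

theorem isImageSum_iff {A : H →ₗ.[ℂ] H} {φ : ℕ → H} {τ : H →L[ℂ] H} :
    IsImageSum A φ τ ↔ ∃ v : ℕ → H, (∀ i, (φ i, v i) ∈ A.graph) ∧ IsDecomposition v τ := by
  constructor
  · rintro ⟨hφ, h⟩
    exact ⟨fun i => A ⟨φ i, hφ i⟩, fun i => A.mem_graph ⟨φ i, hφ i⟩, h⟩
  · rintro ⟨v, hv, h⟩
    refine ⟨fun i => LinearPMap.mem_domain_of_mem_graph (hv i), ?_⟩
    have : v = fun i => A ⟨φ i, LinearPMap.mem_domain_of_mem_graph (hv i)⟩ := by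
      funext i
      exact snd_eq_of_mem_graph (hv i)
        (A.mem_graph ⟨φ i, LinearPMap.mem_domain_of_mem_graph (hv i)⟩)
    rw [this] at h
    exact h

/-- The constants of a `√G`-bounded operator `A`, with `A` and `√G` given by their graphs. -/
structure HasSqrtBound (G A : H →ₗ.[ℂ] H) (a b : ℝ) : Prop where
  exists_mem_graph : ∀ {x w : H}, (x, w) ∈ (sqrtOp G).graph → ∃ v, (x, v) ∈ A.graph
  norm_sq_le : ∀ {x w v : H}, (x, w) ∈ (sqrtOp G).graph → (x, v) ∈ A.graph →
    ‖v‖ ^ 2 ≤ a ^ 2 * ‖x‖ ^ 2 + b ^ 2 * ‖w‖ ^ 2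

theorem IsSqrtBounded.exists_hasSqrtBound {G A : H →ₗ.[ℂ] H} (hA : IsSqrtBounded G A) :
    ∃ a b : ℝ, HasSqrtBound G A a b := by
  obtain ⟨hdom, a, b, -, -, h⟩ := hA
  refine ⟨a, b, ⟨fun {x w} hw => ?_, fun {x w v} hw hv => ?_⟩⟩
  · exact ⟨_, A.mem_graph ⟨x, hdom (LinearPMap.mem_domain_of_mem_graph hw)⟩⟩
  · have hx := LinearPMap.mem_domain_of_mem_graph hw
    have h1 := h ⟨x, hx⟩
    rw [snd_eq_of_mem_graph hw ((sqrtOp G).mem_graph ⟨x, hx⟩),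
      snd_eq_of_mem_graph hv (A.mem_graph ⟨x, hdom hx⟩)]
    exact h1

namespace HasSqrtBound

variable {G A : H →ₗ.[ℂ] H} {a b : ℝ}

theorem summable_sq (hA : HasSqrtBound G A a b) {φ w v : ℕ → H}
    (hw : ∀ i, (φ i, w i) ∈ (sqrtOp G).graph) (hv : ∀ i, (φ i, v i) ∈ A.graph)
    (hφs : Summable fun i => ‖φ i‖ ^ 2) (hws : Summable fun i => ‖w i‖ ^ 2) :
    Summable fun i => ‖v i‖ ^ 2 :=
  ((hφs.mul_left (a ^ 2)).add (hws.mul_left (b ^ 2))).of_nonneg_of_le (fun _ => sq_nonneg _)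
    fun i => hA.norm_sq_le (hw i) (hv i)

/-- The bounded operators `A P n`. -/
theorem exists_mul_cutoff (hA : HasSqrtBound G A a b) {P K : ℕ → H →L[ℂ] H}
    (hK : IsCutoff G P K) (n : ℕ) : ∃ T : H →L[ℂ] H, ∀ x, (P n x, T x) ∈ A.graph := by
  have hdom : ∀ x, P n x ∈ A.domain := fun x => by
    obtain ⟨v, hv⟩ := hA.exists_mem_graph (hK.mem_graph_sqrt n x)
    exact LinearPMap.mem_domain_of_mem_graph hv
  let L : H →ₗ[ℂ] H := A.toFun.comp ((P n).toLinearMap.codRestrict A.domain hdom)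
  have hL : ∀ x, (P n x, L x) ∈ A.graph := fun x => A.mem_graph ⟨_, hdom x⟩
  refine ⟨L.mkContinuous (√(a ^ 2 + b ^ 2 * ‖K n‖ ^ 2)) fun x => ?_, hL⟩
  refine le_of_sq_le_sq ?_ (by positivity)
  rw [mul_pow, Real.sq_sqrt (by positivity)]
  refine (hA.norm_sq_le (hK.mem_graph_sqrt n x) (hL x)).trans ?_
  have h1 := hK.norm_le n x
  have h2 := (K n).le_opNorm x
  calc a ^ 2 * ‖P n x‖ ^ 2 + b ^ 2 * ‖K n x‖ ^ 2
      ≤ a ^ 2 * ‖x‖ ^ 2 + b ^ 2 * (‖K n‖ * ‖x‖) ^ 2 := by gcongr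
    _ = _ := by ring

/-- The √G-bound applied to Pₙx − x: convergence in the graph norm of √G is inherited by A. -/
theorem tendsto_mul_cutoff (hA : HasSqrtBound G A a b) (hG : IsPositiveSelfAdjoint G)
    {P K : ℕ → H →L[ℂ] H} (hK : IsCutoff G P K) {T : ℕ → H →L[ℂ] H}
    (hT : ∀ n x, (P n x, T n x) ∈ A.graph) {x w v : H} (hw : (x, w) ∈ (sqrtOp G).graph)
    (hv : (x, v) ∈ A.graph) : Tendsto (fun n => T n x) atTop (𝓝 v) := by
  rw [tendsto_iff_norm_sub_tendsto_zero]
  have h1 : Tendsto (fun n => √(a ^ 2 * ‖P n x - x‖ ^ 2 + b ^ 2 * ‖K n x - w‖ ^ 2)) atTop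
      (𝓝 0) := by
    have hP := tendsto_iff_norm_sub_tendsto_zero.mp (hK.tendsto x)
    have hK' := tendsto_iff_norm_sub_tendsto_zero.mp (hK.tendsto_of_mem_graph hG hw)
    have := (((hP.pow 2).const_mul (a ^ 2)).add ((hK'.pow 2).const_mul (b ^ 2))).sqrt
    simpa using this
  refine squeeze_zero (fun n => norm_nonneg _) (fun n => ?_) h1
  apply Real.le_sqrt_of_sq_le
  exact hA.norm_sq_le (sub_mem (hK.mem_graph_sqrt n x) hw : (P n x - x, K n x - w) ∈ _)
    (sub_mem (hT n x) hv : (P n x - x, T n x - v) ∈ _)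

/-- The operator `∑ᵢ |Aφᵢ⟩⟨Aφᵢ|` does not depend on the decomposition. -/
theorem decomposition_unique (hA : HasSqrtBound G A a b) (hG : IsPositiveSelfAdjoint G)
    {ρ τ τ' : H →L[ℂ] H} {φ w v φ' w' v' : ℕ → H} (hφ : IsDecomposition φ ρ)
    (hφ' : IsDecomposition φ' ρ) (hφs : Summable fun i => ‖φ i‖ ^ 2)
    (hφs' : Summable fun i => ‖φ' i‖ ^ 2) (hw : ∀ i, (φ i, w i) ∈ (sqrtOp G).graph)
    (hw' : ∀ i, (φ' i, w' i) ∈ (sqrtOp G).graph) (hws : Summable fun i => ‖w i‖ ^ 2)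
    (hws' : Summable fun i => ‖w' i‖ ^ 2) (hv : ∀ i, (φ i, v i) ∈ A.graph)
    (hv' : ∀ i, (φ' i, v' i) ∈ A.graph) (hτ : IsDecomposition v τ) (hτ' : IsDecomposition v' τ') :
    τ = τ' := by
  obtain ⟨P, K, hK⟩ := exists_isCutoff hG
  choose T hT using hA.exists_mul_cutoff hK
  -- The form of (APₙ)ρ(APₙ)* depends on ρ alone, and by dominated convergence it tends to the form
  -- of τ for every decomposition.
  have key : ∀ {τ : H →L[ℂ] H} {φ w v : ℕ → H}, IsDecomposition φ ρ →
      (Summable fun i => ‖φ i‖ ^ 2) → (∀ i, (φ i, w i) ∈ (sqrtOp G).graph) →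
      (Summable fun i => ‖w i‖ ^ 2) → (∀ i, (φ i, v i) ∈ A.graph) → IsDecomposition v τ →
      ∀ y : H, Tendsto (fun n => (⟪(T n).adjoint y, ρ ((T n).adjoint y)⟫_ℂ).re) atTop
        (𝓝 (⟪y, τ y⟫_ℂ).re) := by
    intro τ φ w v hφ hφs hw hws hv hτ y
    rw [← (hτ.hasSum_norm_inner_sq y).tsum_eq]
    have h1 : ∀ n, (⟪(T n).adjoint y, ρ ((T n).adjoint y)⟫_ℂ).re
        = ∑' i, ‖⟪T n (φ i), y⟫_ℂ‖ ^ 2 := fun n => by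
      rw [← (hφ.hasSum_norm_inner_sq _).tsum_eq]
      simp_rw [ContinuousLinearMap.adjoint_inner_right]
    simp_rw [h1]
    refine tendsto_tsum_of_dominated_convergence
      (((hφs.mul_left (a ^ 2)).add (hws.mul_left (b ^ 2))).mul_right (‖y‖ ^ 2)) (fun i => ?_)
      (Eventually.of_forall fun n i => ?_)
    · exact ((hA.tendsto_mul_cutoff hG hK hT (hw i) (hv i)).inner tendsto_const_nhds).norm.pow 2
    · rw [Real.norm_of_nonneg (sq_nonneg _)]
      calc ‖⟪T n (φ i), y⟫_ℂ‖ ^ 2 ≤ (‖T n (φ i)‖ * ‖y‖) ^ 2 := by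
            gcongr; exact norm_inner_le_norm _ _
        _ = ‖T n (φ i)‖ ^ 2 * ‖y‖ ^ 2 := mul_pow _ _ _
        _ ≤ _ := by
            gcongr
            refine (hA.norm_sq_le (hK.mem_graph_sqrt n (φ i)) (hT n (φ i))).trans ?_
            have h2 := hK.norm_le n (φ i)
            have h3 := hK.norm_le_of_mem_graph hG n (hw i)
            gcongr
  have hpos := hτ.isPositive
  have hpos' := hτ'.isPositive
  have hreal : ∀ {S : H →L[ℂ] H}, S.IsPositive → ∀ y, ⟪S y, y⟫_ℂ = ((⟪y, S y⟫_ℂ).re : ℂ) := by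
    intro S hS y
    exact (hS.isSymmetric y y).trans (hS.isSymmetric.coe_re_inner_self_apply y).symm
  have h : τ.toLinearMap = τ'.toLinearMap := by
    rw [← ext_inner_map]
    intro y
    have := tendsto_nhds_unique (key hφ hφs hw hws hv hτ y) (key hφ' hφs' hw' hws' hv' hτ' y)
    show ⟪τ y, y⟫_ℂ = ⟪τ' y, y⟫_ℂ
    rw [hreal hpos, hreal hpos', this]
  exact ContinuousLinearMap.coe_injective h

/-- The operator `AρA*` is given by any decomposition of `ρ`. -/
theorem isImageSum_sandwich (hA : HasSqrtBound G A a b) (hG : IsPositiveSelfAdjoint G)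
    {ρ : H →L[ℂ] H} (hρ : IsTraceClass ρ) (he : energy G ρ < ∞) {φ : ℕ → H}
    (hφ : IsDecomposition φ ρ) : IsImageSum A φ (sandwich A ρ) := by
  have hφs := hφ.isTraceClass_iff.mp hρ
  obtain ⟨w, hw, hws, -⟩ := hφ.exists_sqrt hG hφs he
  choose v hv using fun i => hA.exists_mem_graph (hw i)
  obtain ⟨τ, hτ⟩ := isDecomposition_of_summable (hA.summable_sq hw hv hφs hws)
  have hex : ∃ τ : H →L[ℂ] H, ∃ φ : ℕ → H, IsDecomposition φ ρ ∧ IsImageSum A φ τ :=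
    ⟨τ, φ, hφ, isImageSum_iff.mpr ⟨v, hv, hτ⟩⟩
  rw [sandwich, dif_pos hex]
  -- The chosen operator comes with its own decomposition φ'; uniqueness identifies it with the sum
  -- along φ.
  obtain ⟨φ', hφ', himg⟩ := hex.choose_spec
  obtain ⟨v', hv', hτ'⟩ := isImageSum_iff.mp himg
  have hφs' := hφ'.isTraceClass_iff.mp hρ
  obtain ⟨w', hw', hws', -⟩ := hφ'.exists_sqrt hG hφs' he
  rw [← hA.decomposition_unique hG hφ hφ' hφs hφs' hw hw' hws hws' hv hv' hτ hτ']
  exact isImageSum_iff.mpr ⟨v, hv, hτ⟩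

end HasSqrtBound

end Sandwich

/-! ### Collapsing finite families for three quadratic forms: the Bloch sphere argument. -/

section Convexity

variable {H : Type*} [NormedAddCommGroup H] [InnerProductSpace ℂ H]

/-- Every unit vector of ℝ³ is the Bloch vector of a spinor, here normalised to |α|² + |β|² = 2; the
phase of β is the argument of x + iy. -/
theorem exists_spinor {x y z : ℝ} (h : x ^ 2 + y ^ 2 + z ^ 2 = 1) :
    ∃ α β : ℂ, ‖α‖ ^ 2 = 1 + z ∧ ‖β‖ ^ 2 = 1 - z ∧
      (starRingEnd ℂ) α * β = (x : ℂ) + (y : ℂ) * Complex.I := by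
  have hz1 : 0 ≤ 1 + z := by nlinarith [sq_nonneg x, sq_nonneg y, sq_nonneg (z + 1)]
  have hz2 : 0 ≤ 1 - z := by nlinarith [sq_nonneg x, sq_nonneg y, sq_nonneg (z - 1)]
  set u : ℂ := (x : ℂ) + (y : ℂ) * Complex.I with hu
  refine ⟨(√(1 + z) : ℂ), (√(1 - z) : ℂ) * Complex.exp (u.arg * Complex.I), ?_, ?_, ?_⟩
  · rw [Complex.norm_real, Real.norm_of_nonneg (Real.sqrt_nonneg _), Real.sq_sqrt hz1]
  · rw [norm_mul, Complex.norm_exp_ofReal_mul_I, mul_one, Complex.norm_real,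
      Real.norm_of_nonneg (Real.sqrt_nonneg _), Real.sq_sqrt hz2]
  · rw [Complex.conj_ofReal, ← mul_assoc, ← Complex.ofReal_mul, ← Real.sqrt_mul hz1]
    have h1 : √((1 + z) * (1 - z)) = ‖u‖ := by
      rw [hu, Complex.norm_add_mul_I]
      congr 1
      linarith
    rw [h1, Complex.norm_mul_exp_arg_mul_I]

/-- Two linear equations on ℝ³ have a nonzero solution; normalise it and choose its sign for the
third form. -/
theorem exists_unit_orthogonal (m₁ m₂ m₃ : Fin 3 → ℝ) :
    ∃ x y z : ℝ, x ^ 2 + y ^ 2 + z ^ 2 = 1 ∧ x * m₁ 0 + y * m₁ 1 + z * m₁ 2 = 0 ∧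
      x * m₂ 0 + y * m₂ 1 + z * m₂ 2 = 0 ∧ 0 ≤ x * m₃ 0 + y * m₃ 1 + z * m₃ 2 := by
  let L : (Fin 3 → ℝ) →ₗ[ℝ] (Fin 2 → ℝ) := Matrix.toLin' !![m₁ 0, m₁ 1, m₁ 2; m₂ 0, m₂ 1, m₂ 2]
  have hker : LinearMap.ker L ≠ ⊥ := LinearMap.ker_ne_bot_of_finrank_lt (by simp)
  obtain ⟨n, hn, hn0⟩ := Submodule.exists_mem_ne_zero_of_ne_bot hker
  have h1 : n 0 * m₁ 0 + n 1 * m₁ 1 + n 2 * m₁ 2 = 0 := by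
    have := congrFun (LinearMap.mem_ker.mp hn) 0
    simp [L, Matrix.toLin'_apply, Matrix.mulVec, dotProduct, Fin.sum_univ_three] at this
    linarith
  have h2 : n 0 * m₂ 0 + n 1 * m₂ 1 + n 2 * m₂ 2 = 0 := by
    have := congrFun (LinearMap.mem_ker.mp hn) 1
    simp [L, Matrix.toLin'_apply, Matrix.mulVec, dotProduct, Fin.sum_univ_three] at this
    linarith
  have hpos : 0 < n 0 ^ 2 + n 1 ^ 2 + n 2 ^ 2 := by
    by_contra hle
    apply hn0
    have e0 : n 0 = 0 := by nlinarith [sq_nonneg (n 0), sq_nonneg (n 1), sq_nonneg (n 2)]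
    have e1 : n 1 = 0 := by nlinarith [sq_nonneg (n 0), sq_nonneg (n 1), sq_nonneg (n 2)]
    have e2 : n 2 = 0 := by nlinarith [sq_nonneg (n 0), sq_nonneg (n 1), sq_nonneg (n 2)]
    funext i
    fin_cases i <;> simpa
  set c := (√(n 0 ^ 2 + n 1 ^ 2 + n 2 ^ 2))⁻¹ with hc
  have hc2 : c ^ 2 * (n 0 ^ 2 + n 1 ^ 2 + n 2 ^ 2) = 1 := by
    rw [hc, inv_pow, Real.sq_sqrt hpos.le, inv_mul_cancel₀ hpos.ne']
  have hc0 : 0 ≤ c := by positivity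
  rcases le_total 0 (n 0 * m₃ 0 + n 1 * m₃ 1 + n 2 * m₃ 2) with h3 | h3
  · refine ⟨c * n 0, c * n 1, c * n 2, by linarith, ?_, ?_, ?_⟩
    · linear_combination c * h1
    · linear_combination c * h2
    · have := mul_nonneg hc0 h3
      linarith
  · refine ⟨-c * n 0, -c * n 1, -c * n 2, by linarith, ?_, ?_, ?_⟩
    · linear_combination -c * h1
    · linear_combination -c * h2
    · have := mul_nonneg hc0 (neg_nonneg.mpr h3)
      linarith

theorem norm_smul_add_smul_sq {α β : ℂ} {x y z : ℝ} (hα : ‖α‖ ^ 2 = 1 + z) (hβ : ‖β‖ ^ 2 = 1 - z)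
    (hαβ : (starRingEnd ℂ) α * β = (x : ℂ) + (y : ℂ) * Complex.I) (u v : H) :
    ‖α • u + β • v‖ ^ 2 = ‖u‖ ^ 2 + ‖v‖ ^ 2 + (x * (2 * (⟪u, v⟫_ℂ).re)
      + y * (-2 * (⟪u, v⟫_ℂ).im) + z * (‖u‖ ^ 2 - ‖v‖ ^ 2)) := by
  have h1 : ‖α • u + β • v‖ ^ 2
      = ‖α • u‖ ^ 2 + 2 * (⟪α • u, β • v⟫_ℂ).re + ‖β • v‖ ^ 2 := norm_add_sq (𝕜 := ℂ) _ _
  rw [h1, norm_smul, norm_smul, mul_pow, mul_pow, hα, hβ, inner_smul_left, inner_smul_right,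
    ← mul_assoc, hαβ]
  simp
  ring

/-- A pair of vectors can be replaced by a single one that has the same sum of the first two
quadratic forms, and at least the same sum of the third one. -/
theorem exists_sum_two {F : Type*} [AddCommGroup F] [Module ℂ F] (T₁ T₂ T₃ : F →ₗ[ℂ] H)
    (u v : F) : ∃ w : F, ‖T₁ w‖ ^ 2 = ‖T₁ u‖ ^ 2 + ‖T₁ v‖ ^ 2 ∧
      ‖T₂ w‖ ^ 2 = ‖T₂ u‖ ^ 2 + ‖T₂ v‖ ^ 2 ∧ ‖T₃ u‖ ^ 2 + ‖T₃ v‖ ^ 2 ≤ ‖T₃ w‖ ^ 2 := by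
  -- The coefficients of (x, y, z) in `norm_smul_add_smul_sq`; their pairing with the Bloch vector
  -- is the excess over the sum on u and v.
  let m : (F →ₗ[ℂ] H) → Fin 3 → ℝ := fun T =>
    ![2 * (⟪T u, T v⟫_ℂ).re, -2 * (⟪T u, T v⟫_ℂ).im, ‖T u‖ ^ 2 - ‖T v‖ ^ 2]
  obtain ⟨x, y, z, hn, h1, h2, h3⟩ := exists_unit_orthogonal (m T₁) (m T₂) (m T₃)
  obtain ⟨α, β, hα, hβ, hαβ⟩ := exists_spinor hn
  refine ⟨α • u + β • v, ?_, ?_, ?_⟩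
  · rw [map_add, map_smul, map_smul, norm_smul_add_smul_sq hα hβ hαβ]
    exact add_eq_left.mpr h1
  · rw [map_add, map_smul, map_smul, norm_smul_add_smul_sq hα hβ hαβ]
    exact add_eq_left.mpr h2
  · rw [map_add, map_smul, map_smul, norm_smul_add_smul_sq hα hβ hαβ]
    exact le_add_of_nonneg_right h3

theorem exists_sum_finset {F ι : Type*} [AddCommGroup F] [Module ℂ F] (T₁ T₂ T₃ : F →ₗ[ℂ] H)
    (s : Finset ι) (u : ι → F) : ∃ w : F, ‖T₁ w‖ ^ 2 = ∑ i ∈ s, ‖T₁ (u i)‖ ^ 2 ∧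
      ‖T₂ w‖ ^ 2 = ∑ i ∈ s, ‖T₂ (u i)‖ ^ 2 ∧ ∑ i ∈ s, ‖T₃ (u i)‖ ^ 2 ≤ ‖T₃ w‖ ^ 2 := by
  classical
  induction s using Finset.induction_on with
  | empty => exact ⟨0, by simp⟩
  | insert i s hi ih =>
    obtain ⟨w, h1, h2, h3⟩ := ih
    obtain ⟨w', h1', h2', h3'⟩ := exists_sum_two T₁ T₂ T₃ (u i) w
    refine ⟨w', ?_, ?_, ?_⟩
    · rw [Finset.sum_insert hi, h1', h1]
    · rw [Finset.sum_insert hi, h2', h2]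
    · rw [Finset.sum_insert hi]
      linarith

end Convexity
-- Comparison of the four suprema.
section ENorm

set_option linter.unusedSectionVars false

open Filter Topology Set

variable {H : Type*} [NormedAddCommGroup H] [InnerProductSpace ℂ H] [CompleteSpace H]

theorem mem_vectorValues_iff {G A : H →ₗ.[ℂ] H} {E : ℝ} {V : Set H} {r : ℝ} :
    r ∈ vectorValues G A E V ↔ ∃ x w v : H, (x, w) ∈ (sqrtOp G).graph ∧ (x, v) ∈ A.graph ∧
      x ∈ V ∧ ‖w‖ ^ 2 ≤ E ∧ r = ‖v‖ := by
  constructor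
  · rintro ⟨φ, hφ, hV, hE, rfl⟩
    exact ⟨φ, sqrtOp G φ, A ⟨φ, hφ⟩, (sqrtOp G).mem_graph φ, A.mem_graph ⟨φ, hφ⟩, hV, hE, rfl⟩
  · rintro ⟨x, w, v, hw, hv, hV, hE, rfl⟩
    have hx := LinearPMap.mem_domain_of_mem_graph hw
    have hx' := LinearPMap.mem_domain_of_mem_graph hv
    refine ⟨⟨x, hx⟩, hx', hV, ?_, ?_⟩
    · rwa [← snd_eq_of_mem_graph hw ((sqrtOp G).mem_graph ⟨x, hx⟩)]
    · rw [← snd_eq_of_mem_graph hv (A.mem_graph ⟨x, hx'⟩)]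

namespace HasSqrtBound

variable {G A : H →ₗ.[ℂ] H} {a b : ℝ}

/-- The three forms on the domain of √G come from the inclusion, √G and A, so norm and energy are
preserved exactly while A can only gain. -/
theorem exists_sum_finset (hA : HasSqrtBound G A a b) (s : Finset ℕ) {φ w v : ℕ → H}
    (hw : ∀ i, (φ i, w i) ∈ (sqrtOp G).graph) (hv : ∀ i, (φ i, v i) ∈ A.graph) :
    ∃ x y z : H, (x, y) ∈ (sqrtOp G).graph ∧ (x, z) ∈ A.graph ∧ ‖x‖ ^ 2 = ∑ i ∈ s, ‖φ i‖ ^ 2 ∧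
      ‖y‖ ^ 2 = ∑ i ∈ s, ‖w i‖ ^ 2 ∧ ∑ i ∈ s, ‖v i‖ ^ 2 ≤ ‖z‖ ^ 2 := by
  have hdom : (sqrtOp G).domain ≤ A.domain := fun x hx => by
    obtain ⟨v, hv⟩ := hA.exists_mem_graph ((sqrtOp G).mem_graph ⟨x, hx⟩)
    exact LinearPMap.mem_domain_of_mem_graph hv
  have hφ : ∀ i, φ i ∈ (sqrtOp G).domain := fun i => LinearPMap.mem_domain_of_mem_graph (hw i)
  obtain ⟨x, h1, h2, h3⟩ := EnergyNorm.exists_sum_finset (sqrtOp G).domain.subtype (sqrtOp G).toFun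
    (A.toFun.comp (Submodule.inclusion hdom)) s fun i => ⟨φ i, hφ i⟩
  have hw' : ∀ i, (sqrtOp G).toFun ⟨φ i, hφ i⟩ = w i := fun i =>
    snd_eq_of_mem_graph ((sqrtOp G).mem_graph ⟨φ i, hφ i⟩) (hw i)
  have hv' : ∀ i, (A.toFun.comp (Submodule.inclusion hdom)) ⟨φ i, hφ i⟩ = v i := fun i =>
    snd_eq_of_mem_graph (A.mem_graph ⟨φ i, hdom (hφ i)⟩) (hv i)
  simp_rw [hw'] at h2
  simp_rw [hv'] at h3
  exact ⟨x, sqrtOp G x, A ⟨x, hdom x.2⟩, (sqrtOp G).mem_graph x, A.mem_graph ⟨x, hdom x.2⟩, h1,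
    h2, h3⟩

end HasSqrtBound

/-- `inf ‖Gφ‖ = 0` gives unit vectors of arbitrarily small energy. -/
theorem exists_unit_small_energy {G : H →ₗ.[ℂ] H} (hG : IsPositiveSelfAdjoint G)
    (hGinf : ∀ ε : ℝ, 0 < ε → ∃ φ : G.domain, ‖(φ : H)‖ = 1 ∧ ‖G φ‖ < ε) {ε : ℝ} (hε : 0 < ε) :
    ∃ x w : H, (x, w) ∈ (sqrtOp G).graph ∧ ‖x‖ = 1 ∧ ‖w‖ ^ 2 ≤ ε := by
  obtain ⟨φ, h1, h2⟩ := hGinf ε hε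
  obtain ⟨hS, hSG⟩ := sqrtOp_isPositiveSqrt hG
  obtain ⟨w, hw, hw'⟩ := (hSG _ _).mp (G.mem_graph φ)
  refine ⟨φ, w, hw, h1, ?_⟩
  rw [← re_inner_self, inner_eq_of_mem_graph hS.1 hw hw']
  refine (Complex.re_le_norm _).trans ((norm_inner_le_norm _ _).trans ?_)
  rw [h1, one_mul]
  exact h2.le

theorem isLUB_vectorValues_sphere {G A : H →ₗ.[ℂ] H} (hG : IsPositiveSelfAdjoint G)
    (hGinf : ∀ ε : ℝ, 0 < ε → ∃ φ : G.domain, ‖(φ : H)‖ = 1 ∧ ‖G φ‖ < ε) {a b : ℝ}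
    (hA : HasSqrtBound G A a b) {E : ℝ} (hE : 0 < E) :
    IsLUB (vectorValues G A E (Metric.sphere 0 1)) (operatorENorm G A E) := by
  apply isLUB_csSup
  · obtain ⟨x, w, hw, hx, hwE⟩ := exists_unit_small_energy hG hGinf hE
    obtain ⟨v, hv⟩ := hA.exists_mem_graph hw
    exact ⟨_, mem_vectorValues_iff.mpr ⟨x, w, v, hw, hv, by simpa using hx, hwE, rfl⟩⟩
  · refine ⟨√(a ^ 2 + b ^ 2 * E), fun r hr => ?_⟩
    obtain ⟨x, w, v, hw, hv, hx, hwE, rfl⟩ := mem_vectorValues_iff.mp hr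
    have hx' : ‖x‖ = 1 := by simpa using hx
    apply Real.le_sqrt_of_sq_le
    refine (hA.norm_sq_le hw hv).trans ?_
    rw [hx', one_pow, mul_one]
    gcongr

/-- Passes from the unit ball to the sphere. The shrunken vector cx is merged with t times a
low-energy unit vector, where t² = 1 − c²‖x‖² restores norm one. -/
theorem norm_le_operatorENorm {G A : H →ₗ.[ℂ] H} (hG : IsPositiveSelfAdjoint G)
    (hGinf : ∀ ε : ℝ, 0 < ε → ∃ φ : G.domain, ‖(φ : H)‖ = 1 ∧ ‖G φ‖ < ε) {a b : ℝ}
    (hA : HasSqrtBound G A a b) {E : ℝ} (hE : 0 < E) {x w v : H}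
    (hw : (x, w) ∈ (sqrtOp G).graph) (hv : (x, v) ∈ A.graph) (hx : ‖x‖ ≤ 1) (hwE : ‖w‖ ^ 2 ≤ E) :
    ‖v‖ ≤ operatorENorm G A E := by
  have hlub := isLUB_vectorValues_sphere hG hGinf hA hE
  have hscale : ∀ c : ℝ, 0 ≤ c → c < 1 → c * ‖v‖ ≤ operatorENorm G A E := by
    intro c hc0 hc1
    have hc2 : c ^ 2 < 1 := pow_lt_one₀ hc0 hc1 two_ne_zero
    have hx2 : ‖x‖ ^ 2 ≤ 1 := pow_le_one₀ (norm_nonneg _) hx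
    have ht : 0 ≤ 1 - c ^ 2 * ‖x‖ ^ 2 := by nlinarith [sq_nonneg ‖x‖]
    -- Scaling by c frees the energy (1 − c²)E, and t² ≤ 1, so the merged vector has energy at most
    -- c²E + (1 − c²)E = E.
    obtain ⟨y, z, hz, hy, hzE⟩ := exists_unit_small_energy hG hGinf
      (mul_pos (sub_pos.mpr hc2) hE)
    obtain ⟨u, hu⟩ := hA.exists_mem_graph hz
    set t := √(1 - c ^ 2 * ‖x‖ ^ 2) with ht'
    have ht2 : t ^ 2 = 1 - c ^ 2 * ‖x‖ ^ 2 := Real.sq_sqrt ht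
    have hsm : ∀ {T : H →ₗ.[ℂ] H} {p q : H} (r : ℝ), (p, q) ∈ T.graph →
        ((r : ℂ) • p, (r : ℂ) • q) ∈ T.graph := fun {T p q} r h => T.graph.smul_mem (r : ℂ) h
    have hnsm : ∀ (r : ℝ) (p : H), ‖(r : ℂ) • p‖ ^ 2 = r ^ 2 * ‖p‖ ^ 2 := fun r p => by
      rw [norm_smul, mul_pow, Complex.norm_real, Real.norm_eq_abs, sq_abs]
    let f : ℕ → H → H → H := fun i p q => if i = 0 then (c : ℂ) • p else (t : ℂ) • q
    obtain ⟨x', w', v', hw', hv', h1, h2, h3⟩ := hA.exists_sum_finset (Finset.range 2)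
      (φ := fun i => f i x y) (w := fun i => f i w z) (v := fun i => f i v u)
      (fun i => by
        by_cases hi : i = 0
        · simp only [f, hi, if_true]; exact hsm c hw
        · simp only [f, hi, if_false]; exact hsm t hz)
      (fun i => by
        by_cases hi : i = 0
        · simp only [f, hi, if_true]; exact hsm c hv
        · simp only [f, hi, if_false]; exact hsm t hu)
    simp only [f, Finset.sum_range_succ, Finset.sum_range_zero, zero_add, if_true, one_ne_zero,
      if_false, hnsm, hy, ht2] at h1 h2 h3
    have hx' : ‖x'‖ = 1 := by
      have : ‖x'‖ ^ 2 = 1 := by rw [h1]; ring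
      exact (pow_eq_one_iff_of_nonneg (norm_nonneg _) two_ne_zero).mp this
    have hw'E : ‖w'‖ ^ 2 ≤ E := by
      rw [h2]
      have e1 : c ^ 2 * ‖w‖ ^ 2 ≤ c ^ 2 * E := by gcongr
      have e2 : (1 - c ^ 2 * ‖x‖ ^ 2) * ‖z‖ ^ 2 ≤ 1 * ((1 - c ^ 2) * E) := by
        gcongr
        nlinarith [mul_nonneg (sq_nonneg c) (sq_nonneg ‖x‖)]
      linarith
    have h4 : ‖v'‖ ≤ operatorENorm G A E := hlub.1
      (mem_vectorValues_iff.mpr ⟨x', w', v', hw', hv', by simpa using hx', hw'E, rfl⟩)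
    refine le_trans (le_of_sq_le_sq ?_ (norm_nonneg v')) h4
    rw [mul_pow]
    refine le_trans ?_ h3
    have := mul_nonneg ht (sq_nonneg ‖u‖)
    linarith
  have hlim : Tendsto (fun c : ℝ => c * ‖v‖) (𝓝[<] 1) (𝓝 (1 * ‖v‖)) :=
    ((continuous_id.mul continuous_const).tendsto (1 : ℝ)).mono_left nhdsWithin_le_nhds
  rw [one_mul] at hlim
  refine le_of_tendsto hlim ?_
  filter_upwards [Ioo_mem_nhdsLT (show (0 : ℝ) < 1 from one_pos)] with c hc
  exact hscale c hc.1.le hc.2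

theorem le_operatorENorm_of_mem_stateValues {G A : H →ₗ.[ℂ] H} (hG : IsPositiveSelfAdjoint G)
    (hGinf : ∀ ε : ℝ, 0 < ε → ∃ φ : G.domain, ‖(φ : H)‖ = 1 ∧ ‖G φ‖ < ε) {a b : ℝ}
    (hA : HasSqrtBound G A a b) {E : ℝ} (hE : 0 < E) {r : ℝ}
    (hr : r ∈ stateValues G A E (SubStates H)) : r ≤ operatorENorm G A E := by
  obtain ⟨ρ, ⟨hρ, htr⟩, he, rfl⟩ := hr
  obtain ⟨φ, hφ⟩ := exists_isDecomposition hρ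
  have hfin : energy G ρ < ∞ := he.trans_lt ENNReal.ofReal_lt_top
  have hφs := hφ.isTraceClass_iff.mp hρ.2
  obtain ⟨w, hw, hws, hen⟩ := hφ.exists_sqrt hG hφs hfin
  obtain ⟨v, hv, hdec⟩ := isImageSum_iff.mp (hA.isImageSum_sandwich hG hρ.2 hfin hφ)
  have hvs := hA.summable_sq hw hv hφs hws
  have h1 := Complex.hasSum_re (hdec.hasSum_trace hvs)
  have h2 := Complex.hasSum_re (hφ.hasSum_trace hφs)
  simp only [Complex.ofReal_re] at h1 h2
  rw [hen, ENNReal.ofReal_le_ofReal_iff hE.le] at he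
  have h0 : 0 ≤ operatorENorm G A E := by
    have := norm_le_operatorENorm hG hGinf hA hE (x := 0) (w := 0) (v := 0)
      (zero_mem _) (zero_mem _) (by simp) (by simpa using hE.le)
    simpa using this
  rw [Real.sqrt_le_left h0]
  -- A finite part of the decomposition merges into one vector, with squared norm at most Tr ρ ≤ 1
  -- and energy at most Tr Gρ ≤ E.
  refine hasSum_le_of_sum_le h1 fun s => ?_
  obtain ⟨x', w', v', hw', hv', e1, e2, e3⟩ := hA.exists_sum_finset s hw hv
  refine e3.trans ?_
  gcongr
  refine norm_le_operatorENorm hG hGinf hA hE hw' hv' ?_ ?_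
  · refine (sq_le_one_iff₀ (norm_nonneg _)).mp ?_
    rw [e1]
    exact (sum_le_hasSum s (fun i _ => sq_nonneg _) h2).trans htr
  · rw [e2]
    exact (hws.sum_le_tsum s fun i _ => sq_nonneg _).trans he

/-- The pure state of a unit vector `φ` contributes the value `‖Aφ‖`. -/
theorem vectorValues_sphere_subset {G A : H →ₗ.[ℂ] H} (hG : IsPositiveSelfAdjoint G) {a b : ℝ}
    (hA : HasSqrtBound G A a b) (E : ℝ) :
    vectorValues G A E (Metric.sphere 0 1) ⊆ stateValues G A E (States H) := by
  intro r hr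
  obtain ⟨x, w, v, hw, hv, hx, hwE, rfl⟩ := mem_vectorValues_iff.mp hr
  have hx' : ‖x‖ = 1 := by simpa using hx
  let f : H → ℕ → H := fun y => Pi.single 0 y
  have hf0 : ∀ y, f y 0 = y := fun y => Pi.single_eq_same _ _
  have hf : ∀ y i, i ≠ 0 → f y i = 0 := fun y i hi => Pi.single_eq_of_ne hi _
  have hsq : ∀ y, HasSum (fun i => ‖f y i‖ ^ 2) (‖y‖ ^ 2) := fun y => by
    have := hasSum_single (f := fun i => ‖f y i‖ ^ 2) 0 fun i hi => by simp [hf y i hi]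
    rwa [hf0] at this
  have hmem : ∀ {T : H →ₗ.[ℂ] H} {p q : H}, (p, q) ∈ T.graph → ∀ i, (f p i, f q i) ∈ T.graph := by
    intro T p q h i
    by_cases hi : i = 0
    · rw [hi, hf0, hf0]; exact h
    · rw [hf _ _ hi, hf _ _ hi]; exact zero_mem _
  have htr : ∀ {y : H} {ρ : H →L[ℂ] H}, IsDecomposition (f y) ρ →
      trace ρ = ((‖y‖ ^ 2 : ℝ) : ℂ) := fun {y ρ} h =>
    (h.hasSum_trace (hsq y).summable).unique (Complex.hasSum_ofReal.mpr (hsq y))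
  obtain ⟨ρ, hρ⟩ := isDecomposition_of_summable (hsq x).summable
  have hρtc : IsTraceClass ρ := hρ.isTraceClass_iff.mpr (hsq x).summable
  have hen : energy G ρ = ENNReal.ofReal (‖w‖ ^ 2) := by
    rw [hρ.energy_of_sqrt hG (hsq x).summable (hmem hw),
      ← ENNReal.ofReal_tsum_of_nonneg (fun _ => sq_nonneg _) (hsq w).summable, (hsq w).tsum_eq]
  obtain ⟨v', hv', hdec⟩ := isImageSum_iff.mp
    (hA.isImageSum_sandwich hG hρtc (hen ▸ ENNReal.ofReal_lt_top) hρ)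
  have hvv : v' = f v := funext fun i => snd_eq_of_mem_graph (hv' i) (hmem hv i)
  rw [hvv] at hdec
  refine ⟨ρ, ⟨⟨hρ.isPositive, hρtc⟩, ?_⟩, ?_, ?_⟩
  · rw [htr hρ, hx']; simp
  · rw [hen]; exact ENNReal.ofReal_le_ofReal hwE
  · rw [htr hdec, Complex.ofReal_re, Real.sqrt_sq (norm_nonneg _)]

end ENorm
end EnergyNorm

theorem proposition6 {H : Type*} [NormedAddCommGroup H] [InnerProductSpace ℂ H] [CompleteSpace H]
    [TopologicalSpace.SeparableSpace H] (hdim : ¬ FiniteDimensional ℂ H)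
    (G : H →ₗ.[ℂ] H) (hG : EnergyNorm.IsPositiveSelfAdjoint G)
    (hGunb : ¬ ∃ C : ℝ, ∀ φ : G.domain, ‖G φ‖ ≤ C * ‖(φ : H)‖)
    (hGinf : ∀ ε : ℝ, 0 < ε → ∃ φ : G.domain, ‖(φ : H)‖ = 1 ∧ ‖G φ‖ < ε)
    (A : H →ₗ.[ℂ] H) (hA : EnergyNorm.IsSqrtBounded G A) (E : ℝ) (hE : 0 < E) :
    -- `AρA*` is well defined by any decomposition of `ρ`, and is a positive trace-class operator
    (∀ ρ ∈ EnergyNorm.PosTraceClass H, EnergyNorm.energy G ρ < ⊤ →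
      EnergyNorm.sandwich A ρ ∈ EnergyNorm.PosTraceClass H ∧
      (∃ φ : ℕ → H, EnergyNorm.IsDecomposition φ ρ) ∧
      ∀ φ : ℕ → H, EnergyNorm.IsDecomposition φ ρ →
        EnergyNorm.IsImageSum A φ (EnergyNorm.sandwich A ρ)) ∧
    -- the vector definition and the state definition coincide
    IsLUB (EnergyNorm.vectorValues G A E (Metric.sphere 0 1)) (EnergyNorm.operatorENorm G A E) ∧
    IsLUB (EnergyNorm.stateValues G A E (EnergyNorm.States H)) (EnergyNorm.operatorENorm G A E) ∧
    -- the suprema may be taken over the unit ball and over subnormalised positive operators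
    IsLUB (EnergyNorm.vectorValues G A E (Metric.closedBall 0 1))
      (EnergyNorm.operatorENorm G A E) ∧
    IsLUB (EnergyNorm.stateValues G A E (EnergyNorm.SubStates H))
      (EnergyNorm.operatorENorm G A E) := by
  obtain ⟨a, b, hab⟩ := hA.exists_hasSqrtBound
  have hlub := EnergyNorm.isLUB_vectorValues_sphere hG hGinf hab hE
  have hsub := EnergyNorm.vectorValues_sphere_subset hG hab E
  have hstates : EnergyNorm.stateValues G A E (EnergyNorm.States H) ⊆
      EnergyNorm.stateValues G A E (EnergyNorm.SubStates H) := by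
    rintro r ⟨ρ, ⟨hρ, htr⟩, he, rfl⟩
    exact ⟨ρ, ⟨hρ, by rw [htr]; simp⟩, he, rfl⟩
  have hle : ∀ r ∈ EnergyNorm.stateValues G A E (EnergyNorm.SubStates H),
      r ≤ EnergyNorm.operatorENorm G A E := fun r hr =>
    EnergyNorm.le_operatorENorm_of_mem_stateValues hG hGinf hab hE hr
  refine ⟨fun ρ hρ he => ?_, hlub, ?_, ?_, ?_⟩
  · obtain ⟨φ, hφ⟩ := EnergyNorm.exists_isDecomposition hρ
    have himg := hab.isImageSum_sandwich hG hρ.2 he hφ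
    refine ⟨?_, ⟨φ, hφ⟩, fun ψ hψ => hab.isImageSum_sandwich hG hρ.2 he hψ⟩
    obtain ⟨v, hv, hdec⟩ := EnergyNorm.isImageSum_iff.mp himg
    have hφs := hφ.isTraceClass_iff.mp hρ.2
    obtain ⟨w, hw, hws, -⟩ := hφ.exists_sqrt hG hφs he
    exact ⟨hdec.isPositive, hdec.isTraceClass_iff.mpr (hab.summable_sq hw hv hφs hws)⟩
  · exact ⟨fun r hr => hle r (hstates hr), fun d hd => hlub.2 fun r hr => hd (hsub hr)⟩
  · refine ⟨fun r hr => ?_, fun d hd => hlub.2 fun r hr => hd ?_⟩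
    · obtain ⟨x, w, v, hw, hv, hx, hwE, rfl⟩ := EnergyNorm.mem_vectorValues_iff.mp hr
      exact EnergyNorm.norm_le_operatorENorm hG hGinf hab hE hw hv (by simpa using hx) hwE
    · obtain ⟨φ, hφ, hV, hE', rfl⟩ := hr
      exact ⟨φ, hφ, Metric.sphere_subset_closedBall hV, hE', rfl⟩
  · exact ⟨hle, fun d hd => hlub.2 fun r hr => hd (hstates (hsub hr))⟩
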